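/- Let $K$ be a field, $S=K[x_1,\dots,x_n]$ with the standard grading, and for a proper graded ideal $J\subset S$ let \[0\to\bigoplus_{j=1}^{b_p}S(-d_{pj})\to\cdots\to\bigoplus_{j=1}^{b_1}S(-d_{1j})\to S\to S/J\to 0\] be the graded minimal free resolution of $S/J$ over $S$. Put $M_i(J)=\max_j d_{ij}$ and $m_i(J)=\min_j d_{ij}$ for $1\le i\le p$, and let $e(S/J)$ denote the multiplicity of $S/J$, i.e. $(\deg P)!$ times the leading coefficient of the Hilbert polynomial $P$ of $S/J$ if $P\neq 0$, and $\dim_K S/J$ if $P=0$. Let $I\subset S$ be a proper graded ideal of codimension (height) $s$, not necessarily perfect, such that \[\frac{1}{s!}\prod_{i=1}^{s} m_i(I)\ \le\ e(S/I)\ \le\ \frac{1}{s!}\prod_{i=1}^{s} M_i(I),\] and let $f_1,\dots,f_m\in S$ be homogeneous polynomials forming a regular sequence on $S/I$ (in particular $(I,f_1,\dots,f_m)\ne S$). Then \[\frac{1}{(s+m)!}\prod_{i=1}^{s+m} m_i(I,f_1,\dots,f_m)\ \le\ e\bigl(S/(I,f_1,\dots,f_m)\bigr)\ \le\ \frac{1}{(s+m)!}\prod_{i=1}^{s+m}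 M_i(I,f_1,\dots,f_m).\] -/

import Mathlib

noncomputable section

namespace GradedIdeal

variable {K : Type*} [Field K] {n : ℕ}

attribute [local instance] MvPolynomial.gradedAlgebra

/-- `I` is a graded ideal for the standard grading of `K[x₁, …, xₙ]`. -/
def IsGraded (I : Ideal (MvPolynomial (Fin n) K)) : Prop :=
  I.IsHomogeneous (MvPolynomial.homogeneousSubmodule (Fin n) K)

/-- A vector `v` of the graded free module `⨁ₖ S(-a k)`, `S = K[x₁, …, xₙ]`, is homogeneous of
degree `t` if each nonzero coordinate `v k` is a homogeneous polynomial of degree `t - a k`. -/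
def IsHomogeneousVec {b : ℕ} (a : Fin b → ℕ) (t : ℕ)
    (v : Fin b → MvPolynomial (Fin n) K) : Prop :=
  ∀ k, v k = 0 ∨ ∃ e, a k + e = t ∧ (v k).IsHomogeneous e

/-- A (finite) graded minimal free resolution
`0 → F_p → ⋯ → F_1 → F_0 → S/I → 0` over `S = K[x₁, …, xₙ]`,
where `F_i = ⨁ⱼ S(-shift i j)`, `j = 1, …, rank i`, and all maps are homogeneous of degree `0`. -/
structure MinimalResolution (I : Ideal (MvPolynomial (Fin n) K)) where
  /-- the rank of `F_i` -/
  rank : ℕ → ℕ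
  /-- the shifts of `F_i` -/
  shift : (i : ℕ) → Fin (rank i) → ℕ
  /-- the differential `F_{i+1} → F_i` -/
  d : (i : ℕ) → (Fin (rank (i + 1)) → MvPolynomial (Fin n) K) →ₗ[MvPolynomial (Fin n) K]
    (Fin (rank i) → MvPolynomial (Fin n) K)
  /-- the augmentation `F_0 → S/I` -/
  aug : (Fin (rank 0) → MvPolynomial (Fin n) K) →ₗ[MvPolynomial (Fin n) K]
    (MvPolynomial (Fin n) K ⧸ I)
  d_homogeneous : ∀ i j, IsHomogeneousVec (shift i) (shift (i + 1) j) (d i (Pi.single j 1))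
  aug_homogeneous : ∀ j, ∃ p : MvPolynomial (Fin n) K,
    p.IsHomogeneous (shift 0 j) ∧ aug (Pi.single j 1) = Ideal.Quotient.mk I p
  aug_surjective : Function.Surjective aug
  exact_zero : Function.Exact (d 0) aug
  exact_succ : ∀ i, Function.Exact (d (i + 1)) (d i)
  /-- minimality: `F_{i+1}` is mapped into `(x₁, …, xₙ) F_i` -/
  minimal : ∀ i v k, d i v k ∈ MvPolynomial.idealOfVars (Fin n) K
  finite_length : ∃ p, ∀ i, p < i → rank i = 0

/-- The set of shifts `d_{ij}` occurring in homological degree `i` of the graded minimal free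
resolution of `S/I` (which is unique up to isomorphism). -/
def shifts (I : Ideal (MvPolynomial (Fin n) K)) (i : ℕ) : Set ℕ :=
  {t | ∃ (F : MinimalResolution I) (j : Fin (F.rank i)), F.shift i j = t}

/-- `M_i(I)`, the largest shift in homological degree `i`. -/
def maxShift (I : Ideal (MvPolynomial (Fin n) K)) (i : ℕ) : ℕ := sSup (shifts I i)

/-- `m_i(I)`, the smallest shift in homological degree `i`. -/
def minShift (I : Ideal (MvPolynomial (Fin n) K)) (i : ℕ) : ℕ := sInf (shifts I i)

/-- The Hilbert function `k ↦ dim_K (S/I)_k`. -/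
def hilbertFunction (I : Ideal (MvPolynomial (Fin n) K)) (k : ℕ) : ℕ :=
  Module.finrank K
    ((MvPolynomial.homogeneousSubmodule (Fin n) K k).map (Ideal.Quotient.mkₐ K I).toLinearMap)

/-- `P` is the Hilbert polynomial of `S/I`. -/
def IsHilbertPolynomial (I : Ideal (MvPolynomial (Fin n) K)) (P : Polynomial ℚ) : Prop :=
  ∀ᶠ k : ℕ in Filter.atTop, (hilbertFunction I k : ℚ) = P.eval (k : ℚ)

open Classical in
/-- The Hilbert polynomial of `S/I`. -/
def hilbertPolynomial (I : Ideal (MvPolynomial (Fin n) K)) : Polynomial ℚ :=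
  if h : ∃ P, IsHilbertPolynomial I P then h.choose else 0

open Classical in
/-- The multiplicity `e(S/I)`: `(deg P)!` times the leading coefficient of the Hilbert polynomial
`P` of `S/I` if `P ≠ 0` (positive dimension), and `dim_K S/I` if `P = 0` (finite length). -/
def multiplicity (I : Ideal (MvPolynomial (Fin n) K)) : ℚ :=
  if hilbertPolynomial I = 0 then (Module.finrank K (MvPolynomial (Fin n) K ⧸ I) : ℚ)
  else ((hilbertPolynomial I).natDegree.factorial : ℚ) * (hilbertPolynomial I).leadingCoeff

end GradedIdeal

end

noncomputable section

namespace GradedIdeal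

open MvPolynomial

attribute [local instance] MvPolynomial.gradedAlgebra

variable {K : Type*} [Field K] {n : ℕ}

/-! By induction along the regular sequence (`HasMultiplicityBounds.sup_ofList`) it is enough to add
one form f of degree a > 0, regular on S/I. Write J = (I, f). The mapping cone of multiplication by
f on a minimal resolution of S/I is a minimal resolution of S/J (`MinimalResolution.cone`). Hence,
for shifts of I in degrees up to s, m_i(J) ≤ m_i(I) and m_{i+1}(J) ≤ m_i(I) + a, with the reversed
inequalities for M_i. On the other side, H_J(k) = H_I(k) - H_I(k - a) gives e(S/J) = a e(S/I)
(`multiplicity_sup_span`). What remains is numerical: the product of the s + 1 shifts of J is at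
most, respectively at least, (s + 1) a times the product of the s shifts of I (`prod_Icc_succ_le`,
`le_prod_Icc_succ`). Since `shifts` ranges over all resolutions, its boundedness rests on the
uniqueness of shifts (`exists_shift_eq`). A resolution of S/I is extracted from the hypotheses:
e(S/I) > 0 makes the upper bound fail when there are no shifts, and codimension 0 means I = 0. -/

/-! ### Graded ideals and homogeneous components -/

lemma IsGraded.homogeneousComponent_mem {I : Ideal (MvPolynomial (Fin n) K)} (hI : IsGraded I)
    {p : MvPolynomial (Fin n) K} (hp : p ∈ I) (k : ℕ) : homogeneousComponent k p ∈ I :=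
  MvPolynomial.homogeneousComponent_mem_of_mem hI hp k

lemma isGraded_of_homogeneousComponent_mem {I : Ideal (MvPolynomial (Fin n) K)}
    (h : ∀ p ∈ I, ∀ k, homogeneousComponent k p ∈ I) : IsGraded I := by
  intro k p hp
  have := h p hp k
  rwa [← decomposition.decompose'_apply] at this

lemma homogeneousComponent_mul_right {p g : MvPolynomial (Fin n) K} {e : ℕ}
    (hg : g.IsHomogeneous e) (k : ℕ) :
    homogeneousComponent k (p * g) =
      if e ≤ k then homogeneousComponent (k - e) p * g else 0 := by
  have := DirectSum.coe_decompose_mul_of_right_mem (𝒜 := homogeneousSubmodule (Fin n) K)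
    (a := p) (b := g) k hg
  rw [← decomposition.decompose'_apply, ← decomposition.decompose'_apply]
  exact this

lemma mem_idealOfVars_iff {p : MvPolynomial (Fin n) K} :
    p ∈ idealOfVars (Fin n) K ↔ coeff 0 p = 0 := by
  have := mem_pow_idealOfVars_iff' 1 p
  rw [pow_one] at this
  rw [this]
  constructor
  · intro h
    exact h 0 (by simp)
  · intro h x hx
    have : x = 0 := by
      rw [← Finsupp.degree_eq_zero_iff]
      omega
    rw [this, h]

lemma mem_idealOfVars_of_isHomogeneous {p : MvPolynomial (Fin n) K} {e : ℕ}
    (hp : p.IsHomogeneous e) (he : e ≠ 0) : p ∈ idealOfVars (Fin n) K :=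
  mem_idealOfVars_iff.2 (hp.coeff_eq_zero (by simpa using he.symm))

lemma one_notMem_idealOfVars : (1 : MvPolynomial (Fin n) K) ∉ idealOfVars (Fin n) K := by
  simp [mem_idealOfVars_iff]

/-- The constant term of an element of I is its component of degree 0, so it lies in I; if nonzero
it is a unit. -/
lemma IsGraded.le_idealOfVars {I : Ideal (MvPolynomial (Fin n) K)} (hI : IsGraded I)
    (hne : I ≠ ⊤) : I ≤ idealOfVars (Fin n) K := by
  intro p hp
  rw [mem_idealOfVars_iff]
  by_contra h
  have h0 := hI.homogeneousComponent_mem hp 0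
  rw [homogeneousComponent_zero] at h0
  exact hne (I.eq_top_of_isUnit_mem h0 ((isUnit_iff_ne_zero.2 h).map C))

/-! ### Homogeneous vectors and lifting -/

/-- The homogeneous component of degree `t` of a vector of `⨁ₖ S(-a k)`. -/
def vecComponent {b : ℕ} (a : Fin b → ℕ) (t : ℕ) (v : Fin b → MvPolynomial (Fin n) K) :
    Fin b → MvPolynomial (Fin n) K :=
  fun k ↦ if a k ≤ t then homogeneousComponent (t - a k) (v k) else 0

lemma isHomogeneousVec_vecComponent {b : ℕ} (a : Fin b → ℕ) (t : ℕ)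
    (v : Fin b → MvPolynomial (Fin n) K) : IsHomogeneousVec a t (vecComponent a t v) := by
  intro k
  unfold vecComponent
  split_ifs with h
  · exact Or.inr ⟨t - a k, by omega, homogeneousComponent_isHomogeneous _ _⟩
  · exact Or.inl rfl

lemma IsHomogeneousVec.vecComponent_eq {b : ℕ} {a : Fin b → ℕ} {t : ℕ}
    {v : Fin b → MvPolynomial (Fin n) K} (hv : IsHomogeneousVec a t v) :
    vecComponent a t v = v := by
  funext k
  unfold vecComponent
  rcases hv k with h | ⟨e, he, h⟩
  · simp [h]
  · rw [if_pos (by omega), show t - a k = e by omega, homogeneousComponent_eq_self h]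

lemma map_eq_sum_single {R M : Type*} [CommRing R] [AddCommGroup M] [Module R M] {b : ℕ}
    (L : (Fin b → R) →ₗ[R] M) (w : Fin b → R) : L w = ∑ j, w j • L (Pi.single j 1) := by
  conv_lhs => rw [pi_eq_sum_univ' w, map_sum]
  refine Finset.sum_congr rfl fun j _ ↦ ?_
  rw [map_smul]

/-- A linear functional on a graded free module that is homogeneous of degree `-T` is compatible
with taking homogeneous components. -/
lemma map_vecComponent {b : ℕ} {a : Fin b → ℕ} {T : ℕ}
    (L : (Fin b → MvPolynomial (Fin n) K) →ₗ[MvPolynomial (Fin n) K] MvPolynomial (Fin n) K)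
    (hL : ∀ j, L (Pi.single j 1) = 0 ∨ ∃ e, T + e = a j ∧ (L (Pi.single j 1)).IsHomogeneous e)
    (t : ℕ) (w : Fin b → MvPolynomial (Fin n) K) :
    L (vecComponent a t w) = if T ≤ t then homogeneousComponent (t - T) (L w) else 0 := by
  rw [map_eq_sum_single L w, map_eq_sum_single L (vecComponent a t w), map_sum]
  have hite : (if T ≤ t then ∑ j, homogeneousComponent (t - T) (w j • L (Pi.single j 1)) else 0) =
      ∑ j, if T ≤ t then homogeneousComponent (t - T) (w j • L (Pi.single j 1)) else 0 := by
    split_ifs <;> simp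
  rw [hite]
  refine Finset.sum_congr rfl fun j _ ↦ ?_
  rcases hL j with h | ⟨e, he, h⟩
  · simp [h]
  · rw [smul_eq_mul, smul_eq_mul, homogeneousComponent_mul_right h]
    unfold vecComponent
    -- As T + e = a j, the truncation conditions on the two sides agree.
    split_ifs with h1 h2 h3 h3 h4 <;> try omega
    · congr 3; omega
    all_goals simp

/-- The component of degree t of any preimage works, because each coordinate of L commutes with
taking components. -/
lemma exists_isHomogeneousVec_preimage {b c : ℕ} {a : Fin b → ℕ} {a' : Fin c → ℕ}
    (L : (Fin b → MvPolynomial (Fin n) K) →ₗ[MvPolynomial (Fin n) K]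
      (Fin c → MvPolynomial (Fin n) K))
    (hL : ∀ j, IsHomogeneousVec a' (a j) (L (Pi.single j 1))) {t : ℕ}
    {v : Fin c → MvPolynomial (Fin n) K} (hv : IsHomogeneousVec a' t v)
    (hvL : v ∈ LinearMap.range L) :
    ∃ w, IsHomogeneousVec a t w ∧ L w = v := by
  obtain ⟨w, rfl⟩ := hvL
  refine ⟨vecComponent a t w, isHomogeneousVec_vecComponent _ _ _, ?_⟩
  rw [← hv.vecComponent_eq]
  funext k
  exact map_vecComponent (LinearMap.proj k ∘ₗ L) (fun j ↦ hL j k) t w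

/-- Projectivity of a free module; P lets the lift remember a property of the images of the basis,
in practice homogeneity. -/
lemma exists_linearMap_comp_eq {R M N : Type*} [CommRing R] [AddCommGroup M] [Module R M]
    [AddCommGroup N] [Module R N] {b : ℕ} (φ : (Fin b → R) →ₗ[R] N) (ψ : M →ₗ[R] N)
    (P : Fin b → M → Prop) (h : ∀ j, ∃ w, P j w ∧ ψ w = φ (Pi.single j 1)) :
    ∃ χ : (Fin b → R) →ₗ[R] M, (∀ j, P j (χ (Pi.single j 1))) ∧ ∀ v, ψ (χ v) = φ v := by
  choose w hw hψ using h
  refine ⟨Fintype.linearCombination R w, fun j ↦ ?_, fun v ↦ ?_⟩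
  · rw [Fintype.linearCombination_apply_single, one_smul]
    exact hw j
  · rw [map_eq_sum_single φ v, Fintype.linearCombination_apply, map_sum]
    simp [hψ]

lemma exists_lift_of_forall_mem_range {R M N : Type*} [CommRing R] [AddCommGroup M] [Module R M]
    [AddCommGroup N] [Module R N] {b : ℕ} (φ : (Fin b → R) →ₗ[R] N) (ψ : M →ₗ[R] N)
    (h : ∀ v, φ v ∈ LinearMap.range ψ) :
    ∃ χ : (Fin b → R) →ₗ[R] M, ∀ v, ψ (χ v) = φ v := by
  obtain ⟨χ, -, hχ⟩ := exists_linearMap_comp_eq φ ψ (fun _ _ ↦ True)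
    (fun j ↦ by obtain ⟨w, hw⟩ := h (Pi.single j 1); exact ⟨w, trivial, hw⟩)
  exact ⟨χ, hχ⟩

/-! ### Uniqueness of the shifts -/

namespace MinimalResolution

variable {I : Ideal (MvPolynomial (Fin n) K)}

/-- The target S/I is not free, so the augmentation is first lifted to a functional L into S using
homogeneous representatives. Gradedness of I then allows passing to degree t in the congruence L w ≡
p. -/
lemma exists_isHomogeneousVec_aug_eq (hI : IsGraded I) (G : MinimalResolution I) {t : ℕ}
    {p : MvPolynomial (Fin n) K} (hp : p.IsHomogeneous t) :
    ∃ w, IsHomogeneousVec (G.shift 0) t w ∧ G.aug w = Ideal.Quotient.mk I p := by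
  choose q hq hqa using G.aug_homogeneous
  obtain ⟨w, hw⟩ := G.aug_surjective (Ideal.Quotient.mk I p)
  set L : (Fin (G.rank 0) → MvPolynomial (Fin n) K) →ₗ[MvPolynomial (Fin n) K]
    MvPolynomial (Fin n) K := Fintype.linearCombination _ q with hL
  have haug : ∀ v, G.aug v = Ideal.Quotient.mk I (L v) := by
    intro v
    rw [map_eq_sum_single G.aug v, hL, Fintype.linearCombination_apply, map_sum]
    refine Finset.sum_congr rfl fun j _ ↦ ?_
    rw [hqa]
    rfl
  refine ⟨vecComponent (G.shift 0) t w, isHomogeneousVec_vecComponent _ _ _, ?_⟩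
  rw [haug, map_vecComponent (T := 0) L, if_pos (Nat.zero_le t), Nat.sub_zero]
  · rw [haug, Ideal.Quotient.eq] at hw
    rw [Ideal.Quotient.eq]
    have := hI.homogeneousComponent_mem hw t
    rwa [map_sub, homogeneousComponent_eq_self hp] at this
  · intro j
    right
    refine ⟨G.shift 0 j, zero_add _, ?_⟩
    rw [hL, Fintype.linearCombination_apply_single, one_smul]
    exact hq j

/-- Comparison maps `α : F → G` and `β : G → F` between two graded minimal free resolutions exist in
each homological degree, with `α` homogeneous and `αβ` homotopic to the identity through `h`; by
minimality `αβ` is then the identity modulo `(x₁, …, xₙ)`. -/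
lemma exists_comparison (hI : IsGraded I) (F G : MinimalResolution I) (i : ℕ) :
    ∃ (α : (Fin (F.rank i) → MvPolynomial (Fin n) K) →ₗ[MvPolynomial (Fin n) K]
        (Fin (G.rank i) → MvPolynomial (Fin n) K))
      (β : (Fin (G.rank i) → MvPolynomial (Fin n) K) →ₗ[MvPolynomial (Fin n) K]
        (Fin (F.rank i) → MvPolynomial (Fin n) K))
      (h : (Fin (G.rank i) → MvPolynomial (Fin n) K) →ₗ[MvPolynomial (Fin n) K]
        (Fin (G.rank (i + 1)) → MvPolynomial (Fin n) K)),
      (∀ j, IsHomogeneousVec (G.shift i) (F.shift i j) (α (Pi.single j 1))) ∧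
      (∀ v, α (F.d i v) ∈ LinearMap.range (G.d i)) ∧
      (∀ v, β (G.d i v) ∈ LinearMap.range (F.d i)) ∧
      (∀ v, α (β (G.d i v)) = G.d i v + G.d i (h (G.d i v))) ∧
      ∀ v k, α (β v) k - v k ∈ idealOfVars (Fin n) K := by
  induction i with
  | zero =>
    obtain ⟨α, hαh, hα⟩ := exists_linearMap_comp_eq F.aug G.aug
      (fun j ↦ IsHomogeneousVec (G.shift 0) (F.shift 0 j)) (fun j ↦ by
        obtain ⟨p, hp, hpa⟩ := F.aug_homogeneous j
        rw [hpa]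
        exact G.exists_isHomogeneousVec_aug_eq hI hp)
    obtain ⟨β, hβ⟩ := exists_lift_of_forall_mem_range G.aug F.aug
      (fun v ↦ F.aug_surjective _)
    obtain ⟨h, hh⟩ := exists_lift_of_forall_mem_range (α ∘ₗ β - LinearMap.id) (G.d 0) (fun v ↦ by
      refine (G.exact_zero _).1 ?_
      simp [hα, hβ])
    refine ⟨α, β, h, hαh, fun v ↦ ?_, fun v ↦ ?_, fun v ↦ ?_, fun v k ↦ ?_⟩
    · refine (G.exact_zero _).1 ?_
      rw [hα]
      exact (F.exact_zero _).2 ⟨v, rfl⟩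
    · refine (F.exact_zero _).1 ?_
      rw [hβ]
      exact (G.exact_zero _).2 ⟨v, rfl⟩
    · rw [hh]; simp
    · have := G.minimal 0 (h v) k
      rw [hh] at this
      simpa using this
  | succ i ih =>
    obtain ⟨α₀, β₀, h₀, hαh₀, hα₀, hβ₀, hh₀, -⟩ := ih
    obtain ⟨α, hαh, hα⟩ := exists_linearMap_comp_eq (α₀ ∘ₗ F.d i) (G.d i)
      (fun j ↦ IsHomogeneousVec (G.shift (i + 1)) (F.shift (i + 1) j)) (fun j ↦ by
        refine exists_isHomogeneousVec_preimage (G.d i) (G.d_homogeneous i) ?_ (hα₀ _)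
        intro k
        have := map_vecComponent (LinearMap.proj k ∘ₗ α₀) (fun j ↦ hαh₀ j k) (F.shift (i + 1) j)
          (F.d i (Pi.single j 1))
        rw [(F.d_homogeneous i j).vecComponent_eq] at this
        have h2 : (α₀ ∘ₗ F.d i) (Pi.single j 1) k =
          (LinearMap.proj k ∘ₗ α₀) (F.d i (Pi.single j 1)) := rfl
        rw [h2, this]
        split_ifs with hk
        · exact Or.inr ⟨_, Nat.add_sub_of_le hk, homogeneousComponent_isHomogeneous _ _⟩
        · exact Or.inl rfl)
    obtain ⟨β, hβ⟩ := exists_lift_of_forall_mem_range (β₀ ∘ₗ G.d i) (F.d i) (fun v ↦ hβ₀ v)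
    simp only [LinearMap.comp_apply] at hα hβ
    -- The map αβ - 1 - h₀d lands in ker d by the homotopy identity carried from degree i, hence in
    -- the next image.
    obtain ⟨h, hh⟩ := exists_lift_of_forall_mem_range
      (α ∘ₗ β - LinearMap.id - h₀ ∘ₗ G.d i) (G.d (i + 1)) (fun v ↦ by
        refine (G.exact_succ i _).1 ?_
        simp [hα, hβ, hh₀])
    refine ⟨α, β, h, hαh, fun v ↦ ?_, fun v ↦ ?_, fun v ↦ ?_, fun v k ↦ ?_⟩
    · refine (G.exact_succ i _).1 ?_
      rw [hα, (F.exact_succ i _).2 ⟨v, rfl⟩, map_zero]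
    · refine (F.exact_succ i _).1 ?_
      rw [hβ, (G.exact_succ i _).2 ⟨v, rfl⟩, map_zero]
    · rw [hh]
      simp [(G.exact_succ i _).2 ⟨v, rfl⟩]
    · have h1 := G.minimal (i + 1) (h v) k
      rw [hh] at h1
      have h2 : h₀ (G.d i v) k ∈ idealOfVars (Fin n) K := by
        rw [map_eq_sum_single h₀, Finset.sum_apply]
        refine Ideal.sum_mem _ fun j _ ↦ ?_
        exact Ideal.mul_mem_right _ _ (G.minimal i v j)
      have := Ideal.add_mem _ h1 h2
      simpa using this

/-- The shifts of a graded minimal free resolution do not depend on the resolution. -/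
lemma exists_shift_eq (hI : IsGraded I) (F G : MinimalResolution I) (i : ℕ)
    (l : Fin (G.rank i)) : ∃ j, F.shift i j = G.shift i l := by
  obtain ⟨α, β, h, hαh, -, -, -, hm⟩ := exists_comparison hI F G i
  -- The (l, l) entry of αβ is 1 modulo the variables. If no shift of F equals that of l, row l of α
  -- consists of forms of positive degree, so this entry lies in the ideal of the variables.
  by_contra! hne
  have h1 := hm (Pi.single l 1) l
  have h2 : α (β (Pi.single l 1)) l ∈ idealOfVars (Fin n) K := by
    rw [map_eq_sum_single α, Finset.sum_apply]
    refine Ideal.sum_mem _ fun j _ ↦ ?_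
    refine Ideal.mul_mem_left _ _ ?_
    rcases hαh j l with h0 | ⟨e, he, h0⟩
    · rw [h0]; exact Ideal.zero_mem _
    · refine mem_idealOfVars_of_isHomogeneous h0 ?_
      rintro rfl
      exact hne j (by omega)
  have h3 := Ideal.sub_mem _ h2 h1
  simp only [Pi.single_eq_same, sub_sub_cancel] at h3
  exact one_notMem_idealOfVars h3

lemma shifts_eq_range (hI : IsGraded I) (F : MinimalResolution I) (i : ℕ) :
    shifts I i = Set.range (F.shift i) := by
  ext t
  constructor
  · rintro ⟨G, l, rfl⟩
    exact exists_shift_eq hI F G i l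
  · rintro ⟨j, rfl⟩
    exact ⟨F, j, rfl⟩

/-- Otherwise all generators of S/I would come from the ideal of the variables, which contains I but
not 1. This later gives m_0(I) = 0. -/
lemma zero_mem_range_shift_zero (hI : IsGraded I) (hne : I ≠ ⊤) (F : MinimalResolution I) :
    0 ∈ Set.range (F.shift 0) := by
  by_contra hsh
  choose q hq hqa using F.aug_homogeneous
  obtain ⟨w, hw⟩ := F.aug_surjective (Ideal.Quotient.mk I 1)
  have h1 : Ideal.Quotient.mk I (∑ j, w j * q j) = Ideal.Quotient.mk I 1 := by
    rw [← hw, map_eq_sum_single F.aug w, map_sum]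
    refine Finset.sum_congr rfl fun j _ ↦ ?_
    rw [hqa]
    rfl
  have h2 := hI.le_idealOfVars hne (Ideal.Quotient.eq.1 h1)
  have h3 : ∑ j, w j * q j ∈ idealOfVars (Fin n) K :=
    Ideal.sum_mem _ fun j _ ↦ Ideal.mul_mem_left _ _
      (mem_idealOfVars_of_isHomogeneous (hq j) fun h ↦ hsh ⟨j, h⟩)
  have h4 := Ideal.sub_mem _ h3 h2
  rw [sub_sub_cancel] at h4
  exact one_notMem_idealOfVars h4

end MinimalResolution

/-! ### Block vectors in a sum of two free modules -/

section Append

variable {R : Type*} [CommRing R] {b c : ℕ}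

/-- The first block of coordinates of a vector. -/
def leftBlock (R : Type*) [CommRing R] (b c : ℕ) : (Fin (b + c) → R) →ₗ[R] (Fin b → R) :=
  LinearMap.funLeft R R (Fin.castAdd c)

/-- The second block of coordinates of a vector. -/
def rightBlock (R : Type*) [CommRing R] (b c : ℕ) : (Fin (b + c) → R) →ₗ[R] (Fin c → R) :=
  LinearMap.funLeft R R (Fin.natAdd b)

lemma leftBlock_apply (v : Fin (b + c) → R) (k : Fin b) :
    leftBlock R b c v k = v (Fin.castAdd c k) := rfl

lemma rightBlock_apply (v : Fin (b + c) → R) (k : Fin c) :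
    rightBlock R b c v k = v (Fin.natAdd b k) := rfl

lemma ext_blocks {v w : Fin (b + c) → R} (hl : leftBlock R b c v = leftBlock R b c w)
    (hr : rightBlock R b c v = rightBlock R b c w) : v = w := by
  funext k
  refine Fin.addCases (fun k ↦ ?_) (fun k ↦ ?_) k
  · exact congrFun hl k
  · exact congrFun hr k

lemma leftBlock_append (x : Fin b → R) (y : Fin c → R) :
    leftBlock R b c (Fin.append x y) = x := by
  funext k; simp [leftBlock_apply]

lemma rightBlock_append (x : Fin b → R) (y : Fin c → R) :
    rightBlock R b c (Fin.append x y) = y := by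
  funext k; simp [rightBlock_apply]

lemma leftBlock_single_castAdd (k : Fin b) :
    leftBlock R b c (Pi.single (Fin.castAdd c k) 1) = Pi.single k 1 := by
  funext l
  simp [leftBlock_apply, Pi.single_apply]

lemma rightBlock_single_castAdd (k : Fin b) :
    rightBlock R b c (Pi.single (Fin.castAdd c k) 1) = 0 := by
  funext l
  rw [rightBlock_apply, Pi.single_eq_of_ne]
  · rfl
  · simp [Fin.ext_iff]; omega

lemma leftBlock_single_natAdd (k : Fin c) :
    leftBlock R b c (Pi.single (Fin.natAdd b k) 1) = 0 := by
  funext l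
  rw [leftBlock_apply, Pi.single_eq_of_ne]
  · rfl
  · simp [Fin.ext_iff]; omega

lemma rightBlock_single_natAdd (k : Fin c) :
    rightBlock R b c (Pi.single (Fin.natAdd b k) 1) = Pi.single k 1 := by
  funext l
  simp [rightBlock_apply, Pi.single_apply]

/-- The linear map into a free module with given blocks. -/
def appendMap {M : Type*} [AddCommGroup M] [Module R M] (φ : M →ₗ[R] (Fin b → R))
    (ψ : M →ₗ[R] (Fin c → R)) : M →ₗ[R] (Fin (b + c) → R) where
  toFun v := Fin.append (φ v) (ψ v)
  map_add' v w := ext_blocks (by simp [leftBlock_append]) (by simp [rightBlock_append])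
  map_smul' r v := ext_blocks (by simp [leftBlock_append]) (by simp [rightBlock_append])

end Append

lemma isHomogeneousVec_of_blocks {b c : ℕ} {a : Fin b → ℕ} {a' : Fin c → ℕ} {t : ℕ}
    {v : Fin (b + c) → MvPolynomial (Fin n) K}
    (hl : IsHomogeneousVec a t (leftBlock _ b c v))
    (hr : IsHomogeneousVec a' t (rightBlock _ b c v)) :
    IsHomogeneousVec (Fin.append a a') t v := by
  intro k
  refine Fin.addCases (fun k ↦ ?_) (fun k ↦ ?_) k
  · simpa [leftBlock_apply] using hl k
  · simpa [rightBlock_apply] using hr k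

lemma isHomogeneousVec_zero {b : ℕ} (a : Fin b → ℕ) (t : ℕ) :
    IsHomogeneousVec a t (0 : Fin b → MvPolynomial (Fin n) K) := fun _ ↦ Or.inl rfl

lemma IsHomogeneousVec.neg_add_right {b : ℕ} {a : Fin b → ℕ} {t : ℕ}
    {v : Fin b → MvPolynomial (Fin n) K} (hv : IsHomogeneousVec a t v) (r : ℕ) :
    IsHomogeneousVec (fun k ↦ a k + r) (t + r) (-v) := by
  intro k
  rcases hv k with h | ⟨e, he, h⟩
  · left; simp [h]
  · exact Or.inr ⟨e, by dsimp only; omega, h.neg⟩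

lemma isHomogeneousVec_smul_single {b : ℕ} (a : Fin b → ℕ) {f : MvPolynomial (Fin n) K} {r : ℕ}
    (hf : f.IsHomogeneous r) (j : Fin b) :
    IsHomogeneousVec a (a j + r) (f • (Pi.single j 1 : Fin b → MvPolynomial (Fin n) K)) := by
  intro k
  by_cases h : k = j
  · subst h
    exact Or.inr ⟨r, rfl, by simpa using hf⟩
  · left; simp [h]

/-! ### The mapping cone of multiplication by a form -/

namespace MinimalResolution

variable {I : Ideal (MvPolynomial (Fin n) K)} (F : MinimalResolution I)

/-- The ranks of the free modules in the mapping cone of multiplication by a form. -/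
def coneRank : ℕ → ℕ
  | 0 => F.rank 0
  | i + 1 => F.rank (i + 1) + F.rank i

/-- The shifts of the free modules in the mapping cone of multiplication by a form of
degree `r`. -/
def coneShift (r : ℕ) : (i : ℕ) → Fin (F.coneRank i) → ℕ
  | 0 => F.shift 0
  | i + 1 => Fin.append (F.shift (i + 1)) (fun j ↦ F.shift i j + r)

/-- The differential of the mapping cone of multiplication by `f` in degree `0`. -/
def coneDZero (f : MvPolynomial (Fin n) K) :
    (Fin (F.rank 1 + F.rank 0) → MvPolynomial (Fin n) K) →ₗ[MvPolynomial (Fin n) K]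
      (Fin (F.rank 0) → MvPolynomial (Fin n) K) :=
  F.d 0 ∘ₗ leftBlock _ (F.rank 1) (F.rank 0) + f • rightBlock _ (F.rank 1) (F.rank 0)

/-- The differential of the mapping cone of multiplication by `f` in positive degrees. -/
def coneDSucc (f : MvPolynomial (Fin n) K) (i : ℕ) :
    (Fin (F.rank (i + 2) + F.rank (i + 1)) → MvPolynomial (Fin n) K) →ₗ[MvPolynomial (Fin n) K]
      (Fin (F.rank (i + 1) + F.rank i) → MvPolynomial (Fin n) K) :=
  appendMap
    (F.d (i + 1) ∘ₗ leftBlock _ (F.rank (i + 2)) (F.rank (i + 1)) +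
      f • rightBlock _ (F.rank (i + 2)) (F.rank (i + 1)))
    (-(F.d i ∘ₗ rightBlock _ (F.rank (i + 2)) (F.rank (i + 1))))

/-- The differential of the mapping cone of multiplication by `f`. -/
def coneD (f : MvPolynomial (Fin n) K) : (i : ℕ) →
    (Fin (F.coneRank (i + 1)) → MvPolynomial (Fin n) K) →ₗ[MvPolynomial (Fin n) K]
      (Fin (F.coneRank i) → MvPolynomial (Fin n) K)
  | 0 => F.coneDZero f
  | i + 1 => F.coneDSucc f i

variable {f : MvPolynomial (Fin n) K} {r : ℕ}

lemma coneDZero_apply (v : Fin (F.rank 1 + F.rank 0) → MvPolynomial (Fin n) K) :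
    F.coneDZero f v = F.d 0 (leftBlock _ (F.rank 1) (F.rank 0) v) +
      f • rightBlock _ (F.rank 1) (F.rank 0) v := rfl

lemma leftBlock_coneDSucc (i : ℕ)
    (v : Fin (F.rank (i + 2) + F.rank (i + 1)) → MvPolynomial (Fin n) K) :
    leftBlock _ (F.rank (i + 1)) (F.rank i) (F.coneDSucc f i v) =
      F.d (i + 1) (leftBlock _ (F.rank (i + 2)) (F.rank (i + 1)) v) +
        f • rightBlock _ (F.rank (i + 2)) (F.rank (i + 1)) v :=
  leftBlock_append _ _

lemma rightBlock_coneDSucc (i : ℕ)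
    (v : Fin (F.rank (i + 2) + F.rank (i + 1)) → MvPolynomial (Fin n) K) :
    rightBlock _ (F.rank (i + 1)) (F.rank i) (F.coneDSucc f i v) =
      -F.d i (rightBlock _ (F.rank (i + 2)) (F.rank (i + 1)) v) :=
  rightBlock_append _ _

lemma d_d_succ (i : ℕ) (v) : F.d i (F.d (i + 1) v) = 0 :=
  (F.exact_succ i _).2 ⟨v, rfl⟩

lemma coneDZero_homogeneous (hf : f.IsHomogeneous r) (j : Fin (F.rank 1 + F.rank 0)) :
    IsHomogeneousVec (F.shift 0) (Fin.append (F.shift 1) (fun j ↦ F.shift 0 j + r) j)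
      (F.coneDZero f (Pi.single j 1)) := by
  refine Fin.addCases (fun k ↦ ?_) (fun k ↦ ?_) j
  · rw [coneDZero_apply, leftBlock_single_castAdd, rightBlock_single_castAdd, smul_zero,
      add_zero, Fin.append_left]
    exact F.d_homogeneous 0 k
  · rw [coneDZero_apply, leftBlock_single_natAdd, rightBlock_single_natAdd, map_zero,
      zero_add, Fin.append_right]
    exact isHomogeneousVec_smul_single (F.shift 0) hf k

lemma coneDSucc_homogeneous (hf : f.IsHomogeneous r) (i : ℕ)
    (j : Fin (F.rank (i + 2) + F.rank (i + 1))) :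
    IsHomogeneousVec (Fin.append (F.shift (i + 1)) (fun j ↦ F.shift i j + r))
      (Fin.append (F.shift (i + 2)) (fun j ↦ F.shift (i + 1) j + r) j)
      (F.coneDSucc f i (Pi.single j 1)) := by
  refine Fin.addCases (fun k ↦ ?_) (fun k ↦ ?_) j
  · rw [Fin.append_left]
    refine isHomogeneousVec_of_blocks ?_ ?_
    · rw [leftBlock_coneDSucc, leftBlock_single_castAdd, rightBlock_single_castAdd, smul_zero,
        add_zero]
      exact F.d_homogeneous (i + 1) k
    · rw [rightBlock_coneDSucc, rightBlock_single_castAdd, map_zero, neg_zero]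
      exact isHomogeneousVec_zero _ _
  · rw [Fin.append_right]
    refine isHomogeneousVec_of_blocks ?_ ?_
    · rw [leftBlock_coneDSucc, leftBlock_single_natAdd, rightBlock_single_natAdd, map_zero,
        zero_add]
      exact isHomogeneousVec_smul_single (F.shift (i + 1)) hf k
    · rw [rightBlock_coneDSucc, rightBlock_single_natAdd]
      exact (F.d_homogeneous i k).neg_add_right r

lemma coneDZero_mem_idealOfVars (hf : f ∈ idealOfVars (Fin n) K)
    (v : Fin (F.rank 1 + F.rank 0) → MvPolynomial (Fin n) K) (k : Fin (F.rank 0)) :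
    F.coneDZero f v k ∈ idealOfVars (Fin n) K := by
  rw [coneDZero_apply]
  exact Ideal.add_mem _ (F.minimal 0 _ k) (Ideal.mul_mem_right _ _ hf)

lemma coneDSucc_mem_idealOfVars (hf : f ∈ idealOfVars (Fin n) K) (i : ℕ)
    (v : Fin (F.rank (i + 2) + F.rank (i + 1)) → MvPolynomial (Fin n) K)
    (k : Fin (F.rank (i + 1) + F.rank i)) :
    F.coneDSucc f i v k ∈ idealOfVars (Fin n) K := by
  refine Fin.addCases (fun k ↦ ?_) (fun k ↦ ?_) k
  · rw [← leftBlock_apply (F.coneDSucc f i v), leftBlock_coneDSucc]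
    exact Ideal.add_mem _ (F.minimal (i + 1) _ k) (Ideal.mul_mem_right _ _ hf)
  · rw [← rightBlock_apply (F.coneDSucc f i v), rightBlock_coneDSucc]
    exact neg_mem (F.minimal i _ k)

/-- The one place where exactness of the cone needs regularity: dx + fy = 0 gives f · aug y = 0,
hence aug y = 0 and y = dz. Then x + fz is a cycle, equal to dw, and (w, -z) maps to (x, y). -/
lemma coneDSucc_exact_coneDZero (hreg : ∀ p, f * p ∈ I → p ∈ I) :
    Function.Exact (F.coneDSucc f 0) (F.coneDZero f) := by
  have hsm : ∀ z : MvPolynomial (Fin n) K ⧸ I, f • z = 0 → z = 0 := by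
    intro z
    obtain ⟨p, rfl⟩ := Ideal.Quotient.mk_surjective z
    intro h
    exact Ideal.Quotient.eq_zero_iff_mem.2 (hreg p (Ideal.Quotient.eq_zero_iff_mem.1 h))
  intro v
  constructor
  · intro h
    rw [coneDZero_apply] at h
    set x := leftBlock _ (F.rank 1) (F.rank 0) v with hx
    set y := rightBlock _ (F.rank 1) (F.rank 0) v with hy
    have h1 := congrArg F.aug h
    rw [map_add, (F.exact_zero _).2 ⟨x, rfl⟩, zero_add, map_smul, map_zero] at h1
    obtain ⟨z, hz⟩ := (F.exact_zero _).1 (hsm _ h1)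
    have h2 : F.d 0 (x + f • z) = 0 := by rw [map_add, map_smul, hz, h]
    obtain ⟨w, hw⟩ := (F.exact_succ 0 _).1 h2
    refine ⟨Fin.append w (-z), ext_blocks (b := F.rank 1) (c := F.rank 0) ?_ ?_⟩
    · rw [leftBlock_coneDSucc, leftBlock_append, rightBlock_append, hw, ← hx]
      simp
    · rw [rightBlock_coneDSucc, rightBlock_append, ← hy, map_neg, neg_neg, hz]
  · rintro ⟨w, rfl⟩
    rw [coneDZero_apply, leftBlock_coneDSucc, rightBlock_coneDSucc, map_add, d_d_succ,
      map_smul]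
    simp

/-- Same chase, but here y is a cycle of positive degree, hence a boundary without any condition on
f. -/
lemma coneDSucc_exact_coneDSucc (i : ℕ) : Function.Exact (F.coneDSucc f (i + 1)) (F.coneDSucc f i) := by
  intro v
  constructor
  · intro h
    have hl := F.leftBlock_coneDSucc (f := f) i v
    have hr := F.rightBlock_coneDSucc (f := f) i v
    rw [h, map_zero] at hl hr
    set x := leftBlock _ (F.rank (i + 2)) (F.rank (i + 1)) v with hx
    set y := rightBlock _ (F.rank (i + 2)) (F.rank (i + 1)) v with hy
    obtain ⟨z, hz⟩ := (F.exact_succ i _).1 (neg_eq_zero.1 hr.symm)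
    have h2 : F.d (i + 1) (x + f • z) = 0 := by rw [map_add, map_smul, hz, ← hl]
    obtain ⟨w, hw⟩ := (F.exact_succ (i + 1) _).1 h2
    refine ⟨Fin.append w (-z), ext_blocks (b := F.rank (i + 2)) (c := F.rank (i + 1)) ?_ ?_⟩
    · rw [leftBlock_coneDSucc, leftBlock_append, rightBlock_append, hw, ← hx]
      simp
    · rw [rightBlock_coneDSucc, rightBlock_append, ← hy, map_neg, neg_neg, hz]
  · rintro ⟨w, rfl⟩
    refine ext_blocks (b := F.rank (i + 1)) (c := F.rank i) ?_ ?_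
    · rw [leftBlock_coneDSucc, leftBlock_coneDSucc, rightBlock_coneDSucc, map_add, d_d_succ,
        map_smul]
      simp
    · rw [rightBlock_coneDSucc, rightBlock_coneDSucc, map_neg, d_d_succ]
      simp

/-- The augmentation of the mapping cone of multiplication by `f`. -/
def coneAug (f : MvPolynomial (Fin n) K) :
    (Fin (F.rank 0) → MvPolynomial (Fin n) K) →ₗ[MvPolynomial (Fin n) K]
      (MvPolynomial (Fin n) K ⧸ (I ⊔ Ideal.span {f})) :=
  Submodule.mapQ I (I ⊔ Ideal.span {f}) LinearMap.id (by simp) ∘ₗ F.aug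

lemma coneAug_apply_of_aug_eq {v : Fin (F.rank 0) → MvPolynomial (Fin n) K}
    {p : MvPolynomial (Fin n) K} (h : F.aug v = Ideal.Quotient.mk I p) :
    F.coneAug f v = Ideal.Quotient.mk (I ⊔ Ideal.span {f}) p := by
  rw [coneAug, LinearMap.comp_apply, h]
  rfl

lemma coneAug_surjective : Function.Surjective (F.coneAug f) := by
  intro z
  obtain ⟨p, rfl⟩ := Ideal.Quotient.mk_surjective z
  obtain ⟨v, hv⟩ := F.aug_surjective (Ideal.Quotient.mk I p)
  exact ⟨v, F.coneAug_apply_of_aug_eq hv⟩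

lemma coneDZero_exact_coneAug : Function.Exact (F.coneDZero f) (F.coneAug f) := by
  intro v
  constructor
  · intro h
    obtain ⟨p, hp⟩ := Ideal.Quotient.mk_surjective (F.aug v)
    rw [F.coneAug_apply_of_aug_eq hp.symm, Ideal.Quotient.eq_zero_iff_mem] at h
    obtain ⟨q, hq, s, hs, rfl⟩ := Submodule.mem_sup.1 h
    obtain ⟨g, rfl⟩ := Ideal.mem_span_singleton'.1 hs
    obtain ⟨y, hy⟩ := F.aug_surjective (Ideal.Quotient.mk I g)
    have h1 : F.aug (v - f • y) = 0 := by
      rw [map_sub, map_smul, hy, ← hp]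
      change Ideal.Quotient.mk I (q + g * f) - Ideal.Quotient.mk I (f * g) = 0
      rw [← map_sub, Ideal.Quotient.eq_zero_iff_mem]
      convert hq using 1
      ring
    obtain ⟨x, hx⟩ := (F.exact_zero _).1 h1
    refine ⟨Fin.append x y, ?_⟩
    rw [coneDZero_apply, leftBlock_append, rightBlock_append, hx, sub_add_cancel]
  · rintro ⟨w, rfl⟩
    rw [coneDZero_apply, map_add, map_smul]
    have h1 : F.coneAug f (F.d 0 (leftBlock _ (F.rank 1) (F.rank 0) w)) = 0 := by
      rw [coneAug, LinearMap.comp_apply, (F.exact_zero _).2 ⟨_, rfl⟩, map_zero]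
    obtain ⟨p, hp⟩ := Ideal.Quotient.mk_surjective
      (F.coneAug f (rightBlock _ (F.rank 1) (F.rank 0) w))
    rw [h1, zero_add, ← hp]
    exact Ideal.Quotient.eq_zero_iff_mem.2 (Ideal.mul_mem_right _ _
      (Ideal.mem_sup_right (Ideal.mem_span_singleton_self f)))

/-- The mapping cone of multiplication by a form `f`, regular on `S/I` and of positive degree `r`,
is a graded minimal free resolution of `S/(I, f)`. -/
def cone (hf : f.IsHomogeneous r) (hr : r ≠ 0) (hreg : ∀ p, f * p ∈ I → p ∈ I) :
    MinimalResolution (I ⊔ Ideal.span {f}) where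
  rank := F.coneRank
  shift := F.coneShift r
  d := F.coneD f
  aug := F.coneAug f
  d_homogeneous i := by
    cases i with
    | zero => exact F.coneDZero_homogeneous hf
    | succ i => exact F.coneDSucc_homogeneous hf i
  aug_homogeneous j := by
    obtain ⟨p, hp, h⟩ := F.aug_homogeneous j
    exact ⟨p, hp, F.coneAug_apply_of_aug_eq h⟩
  aug_surjective := F.coneAug_surjective
  exact_zero := F.coneDZero_exact_coneAug
  exact_succ i := by
    cases i with
    | zero => exact F.coneDSucc_exact_coneDZero hreg
    | succ i => exact F.coneDSucc_exact_coneDSucc i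
  minimal i := by
    cases i with
    | zero => exact F.coneDZero_mem_idealOfVars (mem_idealOfVars_of_isHomogeneous hf hr)
    | succ i => exact F.coneDSucc_mem_idealOfVars (mem_idealOfVars_of_isHomogeneous hf hr) i
  finite_length := by
    obtain ⟨p, hp⟩ := F.finite_length
    refine ⟨p + 1, fun i hi ↦ ?_⟩
    obtain ⟨i, rfl⟩ := Nat.exists_eq_add_of_lt hi
    change F.rank _ + F.rank _ = 0
    rw [hp _ (by omega), hp _ (by omega)]

end MinimalResolution

/-! ### Shifts of (I, f) -/

section Shifts

variable {I : Ideal (MvPolynomial (Fin n) K)} {f : MvPolynomial (Fin n) K} {r : ℕ}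

/-- Comes from the left block of the cone; the right block gives `add_mem_shifts_sup_span`. These
two inclusions suffice to bound the extreme shifts of (I, f). -/
lemma mem_shifts_sup_span (hf : f.IsHomogeneous r) (hr : r ≠ 0)
    (hreg : ∀ p, f * p ∈ I → p ∈ I) {i t : ℕ} (ht : t ∈ shifts I i) :
    t ∈ shifts (I ⊔ Ideal.span {f}) i := by
  obtain ⟨F, j, rfl⟩ := ht
  cases i with
  | zero => exact ⟨F.cone hf hr hreg, j, rfl⟩
  | succ i =>
    refine ⟨F.cone hf hr hreg, Fin.castAdd _ j, ?_⟩
    exact Fin.append_left (F.shift (i + 1)) (fun j ↦ F.shift i j + r) j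

lemma add_mem_shifts_sup_span (hf : f.IsHomogeneous r) (hr : r ≠ 0)
    (hreg : ∀ p, f * p ∈ I → p ∈ I) {i t : ℕ} (ht : t ∈ shifts I i) :
    t + r ∈ shifts (I ⊔ Ideal.span {f}) (i + 1) := by
  obtain ⟨F, j, rfl⟩ := ht
  refine ⟨F.cone hf hr hreg, Fin.natAdd _ j, ?_⟩
  exact Fin.append_right (F.shift (i + 1)) (fun j ↦ F.shift i j + r) j

/-- Needed because `sSup` of an unbounded set of naturals is 0. -/
lemma bddAbove_shifts (hI : IsGraded I) (hF : Nonempty (MinimalResolution I)) (i : ℕ) :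
    BddAbove (shifts I i) := by
  obtain ⟨F⟩ := hF
  rw [F.shifts_eq_range hI i]
  exact (Set.finite_range _).bddAbove

end Shifts

/-! ### The resolution for codimension 0 -/

/-- The graded minimal free resolution of `S` itself. -/
def MinimalResolution.bot : MinimalResolution (⊥ : Ideal (MvPolynomial (Fin n) K)) where
  rank := fun i ↦ if i = 0 then 1 else 0
  shift := fun _ _ ↦ 0
  d := fun _ ↦ 0
  aug := Submodule.mkQ _ ∘ₗ LinearMap.proj (⟨0, by simp⟩ : Fin (if 0 = 0 then 1 else 0))
  d_homogeneous _ j := absurd j.2 (by simp)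
  aug_homogeneous j := by
    refine ⟨1, isHomogeneous_one _ _, ?_⟩
    have : j = ⟨0, by simp⟩ := by
      ext
      have := j.2
      simp only [if_true] at this
      simp only
      omega
    subst this
    simp
  aug_surjective z := by
    obtain ⟨p, rfl⟩ := Ideal.Quotient.mk_surjective z
    exact ⟨fun _ ↦ p, rfl⟩
  exact_zero v := by
    constructor
    · intro h
      refine ⟨0, ?_⟩
      have h0 : v ⟨0, by simp⟩ = 0 := by
        have := Ideal.Quotient.eq_zero_iff_mem.1 h
        simpa using this
      rw [map_zero]
      funext j
      have hj : j = ⟨0, by simp⟩ := by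
        ext
        have := j.2
        simp only [if_true] at this
        simp only
        omega
      rw [hj, h0]
      rfl
    · rintro ⟨w, rfl⟩
      simp
  exact_succ i v := by
    constructor
    · intro _
      exact ⟨0, funext fun j ↦ absurd j.2 (by simp)⟩
    · intro _
      rfl
  minimal _ _ _ := Ideal.zero_mem _
  finite_length := ⟨0, fun i hi ↦ if_neg (by omega)⟩

/-! ### Hilbert functions and their additivity -/

/-- The degree `k` part of `S/I`. -/
def gradedPart (I : Ideal (MvPolynomial (Fin n) K)) (k : ℕ) :
    Submodule K (MvPolynomial (Fin n) K ⧸ I) :=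
  (homogeneousSubmodule (Fin n) K k).map (Ideal.Quotient.mkₐ K I).toLinearMap

lemma hilbertFunction_eq (I : Ideal (MvPolynomial (Fin n) K)) (k : ℕ) :
    hilbertFunction I k = Module.finrank K (gradedPart I k) := rfl

lemma mem_gradedPart {I : Ideal (MvPolynomial (Fin n) K)} {k : ℕ}
    {z : MvPolynomial (Fin n) K ⧸ I} :
    z ∈ gradedPart I k ↔ ∃ p, p.IsHomogeneous k ∧ Ideal.Quotient.mk I p = z := Iff.rfl

instance (I : Ideal (MvPolynomial (Fin n) K)) (k : ℕ) : Module.Finite K (gradedPart I k) := by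
  have : Module.Finite K (homogeneousSubmodule (Fin n) K k) :=
    Module.Finite.iff_fg.2 (homogeneousSubmodule_fg (Fin n) K k)
  exact Module.Finite.map _ _

/-- The ideal quotient `(I : f)`. -/
def quotBy (I : Ideal (MvPolynomial (Fin n) K)) (f : MvPolynomial (Fin n) K) :
    Ideal (MvPolynomial (Fin n) K) :=
  Submodule.comap (LinearMap.mulLeft (MvPolynomial (Fin n) K) f) I

lemma mem_quotBy {I : Ideal (MvPolynomial (Fin n) K)} {f p : MvPolynomial (Fin n) K} :
    p ∈ quotBy I f ↔ f * p ∈ I := Iff.rfl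

lemma le_quotBy (I : Ideal (MvPolynomial (Fin n) K)) (f : MvPolynomial (Fin n) K) :
    I ≤ quotBy I f := fun _ hp ↦ I.mul_mem_left f hp

lemma homogeneousComponent_add_mul_right {p g : MvPolynomial (Fin n) K} {e : ℕ}
    (hg : g.IsHomogeneous e) (k : ℕ) :
    homogeneousComponent (k + e) (p * g) = homogeneousComponent k p * g := by
  rw [homogeneousComponent_mul_right hg, if_pos (by omega), Nat.add_sub_cancel]

lemma IsGraded.quotBy {I : Ideal (MvPolynomial (Fin n) K)} (hI : IsGraded I)
    {f : MvPolynomial (Fin n) K} {a : ℕ} (hf : f.IsHomogeneous a) : IsGraded (quotBy I f) := by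
  refine isGraded_of_homogeneousComponent_mem fun p hp k ↦ ?_
  rw [mem_quotBy, mul_comm] at hp ⊢
  rw [← homogeneousComponent_add_mul_right hf]
  exact hI.homogeneousComponent_mem hp _

lemma IsGraded.sup_span {I : Ideal (MvPolynomial (Fin n) K)} (hI : IsGraded I)
    {f : MvPolynomial (Fin n) K} {a : ℕ} (hf : f.IsHomogeneous a) :
    IsGraded (I ⊔ Ideal.span {f}) := by
  refine Ideal.IsHomogeneous.sup hI (Ideal.homogeneous_span _ _ ?_)
  rintro x rfl
  exact ⟨a, hf⟩

lemma finrank_map_add_finrank_ker_inf {V W : Type*} [AddCommGroup V] [Module K V]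
    [AddCommGroup W] [Module K W] (π : V →ₗ[K] W) (B : Submodule K V) [Module.Finite K B] :
    Module.finrank K (B.map π) + Module.finrank K (LinearMap.ker π ⊓ B : Submodule K V) =
      Module.finrank K B := by
  rw [← LinearMap.finrank_range_add_finrank_ker (π.domRestrict B), LinearMap.range_domRestrict]
  congr 1
  rw [LinearMap.ker_domRestrict]
  exact (LinearEquiv.finrank_eq (Submodule.comapSubtypeEquivOfLe
    (inf_le_right : LinearMap.ker π ⊓ B ≤ B))).symm.trans
    (by rw [Submodule.comap_inf, Submodule.comap_subtype_self, inf_top_eq])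

/-- The projection `S/I → S/(I, f)`. -/
def projSup (I : Ideal (MvPolynomial (Fin n) K)) (f : MvPolynomial (Fin n) K) :
    (MvPolynomial (Fin n) K ⧸ I) →ₗ[K] (MvPolynomial (Fin n) K ⧸ (I ⊔ Ideal.span {f})) :=
  (Ideal.Quotient.factorₐ K (le_sup_left : I ≤ I ⊔ Ideal.span {f})).toLinearMap

lemma projSup_mk (I : Ideal (MvPolynomial (Fin n) K)) (f p : MvPolynomial (Fin n) K) :
    projSup I f (Ideal.Quotient.mk I p) = Ideal.Quotient.mk _ p := rfl

lemma gradedPart_map_projSup (I : Ideal (MvPolynomial (Fin n) K)) (f : MvPolynomial (Fin n) K)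
    (k : ℕ) : (gradedPart I k).map (projSup I f) = gradedPart (I ⊔ Ideal.span {f}) k := by
  rw [gradedPart, gradedPart, ← Submodule.map_comp]
  rfl

/-- Multiplication by `f` as a map `S/(I : f) → S/I`. -/
def mulQuotBy (I : Ideal (MvPolynomial (Fin n) K)) (f : MvPolynomial (Fin n) K) :
    (MvPolynomial (Fin n) K ⧸ quotBy I f) →ₗ[K] (MvPolynomial (Fin n) K ⧸ I) :=
  (Submodule.mapQ (quotBy I f) I (LinearMap.mulLeft _ f) le_rfl).restrictScalars K

lemma mulQuotBy_mk (I : Ideal (MvPolynomial (Fin n) K)) (f p : MvPolynomial (Fin n) K) :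
    mulQuotBy I f (Ideal.Quotient.mk _ p) = Ideal.Quotient.mk _ (f * p) := rfl

lemma mulQuotBy_injective (I : Ideal (MvPolynomial (Fin n) K)) (f : MvPolynomial (Fin n) K) :
    Function.Injective (mulQuotBy I f) := by
  rw [injective_iff_map_eq_zero]
  intro z hz
  obtain ⟨p, rfl⟩ := Ideal.Quotient.mk_surjective z
  rw [mulQuotBy_mk, Ideal.Quotient.eq_zero_iff_mem] at hz
  exact Ideal.Quotient.eq_zero_iff_mem.2 hz

/-- If p = q + gf has degree k + a with q in I, then g may be replaced by its component of degree k: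
the error is a component of q, so it stays in I. -/
lemma ker_projSup_inf_gradedPart {I : Ideal (MvPolynomial (Fin n) K)} (hI : IsGraded I)
    {f : MvPolynomial (Fin n) K} {a : ℕ} (hf : f.IsHomogeneous a) (k : ℕ) :
    LinearMap.ker (projSup I f) ⊓ gradedPart I (k + a) =
      (gradedPart (quotBy I f) k).map (mulQuotBy I f) := by
  ext z
  constructor
  · rintro ⟨hz, hz'⟩
    obtain ⟨p, hp, rfl⟩ := mem_gradedPart.1 hz'
    rw [SetLike.mem_coe, LinearMap.mem_ker, projSup_mk, Ideal.Quotient.eq_zero_iff_mem] at hz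
    obtain ⟨q, hq, s, hs, hqs⟩ := Submodule.mem_sup.1 hz
    obtain ⟨g, rfl⟩ := Ideal.mem_span_singleton'.1 hs
    refine ⟨Ideal.Quotient.mk _ (homogeneousComponent k g),
      mem_gradedPart.2 ⟨_, homogeneousComponent_isHomogeneous _ _, rfl⟩, ?_⟩
    rw [mulQuotBy_mk, Ideal.Quotient.eq, ← neg_mem_iff]
    convert hI.homogeneousComponent_mem hq (k + a) using 1
    rw [← homogeneousComponent_eq_self hp, ← hqs, map_add, homogeneousComponent_add_mul_right hf]
    ring
  · rintro ⟨w, hw, rfl⟩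
    obtain ⟨g, hg, rfl⟩ := mem_gradedPart.1 hw
    rw [mulQuotBy_mk]
    refine ⟨?_, mem_gradedPart.2 ⟨f * g, ?_, rfl⟩⟩
    · rw [SetLike.mem_coe, LinearMap.mem_ker, projSup_mk, Ideal.Quotient.eq_zero_iff_mem]
      exact Ideal.mul_mem_right _ _ (Ideal.mem_sup_right (Ideal.mem_span_singleton_self f))
    · rw [add_comm]; exact hf.mul hg

/-- Additivity of the Hilbert function along `0 → S/(I : f)(-a) → S/I → S/(I, f) → 0`. -/
lemma hilbertFunction_add {I : Ideal (MvPolynomial (Fin n) K)} (hI : IsGraded I)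
    {f : MvPolynomial (Fin n) K} {a : ℕ} (hf : f.IsHomogeneous a) (k : ℕ) :
    hilbertFunction (I ⊔ Ideal.span {f}) (k + a) + hilbertFunction (quotBy I f) k =
      hilbertFunction I (k + a) := by
  have h := finrank_map_add_finrank_ker_inf (projSup I f) (gradedPart I (k + a))
  rw [gradedPart_map_projSup, ker_projSup_inf_gradedPart hI hf] at h
  rw [hilbertFunction_eq, hilbertFunction_eq, hilbertFunction_eq, ← h]
  congr 1
  exact LinearEquiv.finrank_eq (Submodule.equivMapOfInjective _ (mulQuotBy_injective I f) _)

lemma hilbertFunction_sup_of_lt {I : Ideal (MvPolynomial (Fin n) K)} (hI : IsGraded I)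
    {f : MvPolynomial (Fin n) K} {a : ℕ} (hf : f.IsHomogeneous a) {k : ℕ} (hk : k < a) :
    hilbertFunction (I ⊔ Ideal.span {f}) k = hilbertFunction I k := by
  have h := finrank_map_add_finrank_ker_inf (projSup I f) (gradedPart I k)
  have hbot : LinearMap.ker (projSup I f) ⊓ gradedPart I k = ⊥ := by
    rw [eq_bot_iff]
    rintro z ⟨hz, hz'⟩
    obtain ⟨p, hp, rfl⟩ := mem_gradedPart.1 hz'
    rw [SetLike.mem_coe, LinearMap.mem_ker, projSup_mk, Ideal.Quotient.eq_zero_iff_mem] at hz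
    obtain ⟨q, hq, s, hs, hqs⟩ := Submodule.mem_sup.1 hz
    obtain ⟨g, rfl⟩ := Ideal.mem_span_singleton'.1 hs
    rw [Submodule.mem_bot, Ideal.Quotient.eq_zero_iff_mem, ← homogeneousComponent_eq_self hp,
      ← hqs, map_add, homogeneousComponent_mul_right hf, if_neg (by omega), add_zero]
    exact hI.homogeneousComponent_mem hq k
  rw [gradedPart_map_projSup, hbot, finrank_bot, add_zero] at h
  exact h

lemma hilbertFunction_eq_zero_iff {I : Ideal (MvPolynomial (Fin n) K)} {k : ℕ} :
    hilbertFunction I k = 0 ↔ ∀ p : MvPolynomial (Fin n) K, p.IsHomogeneous k → p ∈ I := by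
  rw [hilbertFunction_eq, Submodule.finrank_eq_zero, Submodule.eq_bot_iff]
  constructor
  · intro h p hp
    exact Ideal.Quotient.eq_zero_iff_mem.1 (h _ (mem_gradedPart.2 ⟨p, hp, rfl⟩))
  · intro h z hz
    obtain ⟨p, hp, rfl⟩ := mem_gradedPart.1 hz
    exact Ideal.Quotient.eq_zero_iff_mem.2 (h p hp)

lemma hilbertFunction_zero_ne_zero {I : Ideal (MvPolynomial (Fin n) K)} (hne : I ≠ ⊤) :
    hilbertFunction I 0 ≠ 0 := by
  intro h
  exact hne ((Ideal.eq_top_iff_one I).2 (hilbertFunction_eq_zero_iff.1 h 1 (isHomogeneous_one _ _)))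

/-! ### Existence of the Hilbert polynomial -/

lemma exists_polynomial_eval_eq_sum_range (P : Polynomial ℚ) :
    ∃ Q : Polynomial ℚ, ∀ N : ℕ, ∑ k ∈ Finset.range N, P.eval (k : ℚ) = Q.eval (N : ℚ) := by
  induction P using Polynomial.induction_on' with
  | add p q hp hq =>
    obtain ⟨P, hP⟩ := hp
    obtain ⟨Q, hQ⟩ := hq
    exact ⟨P + Q, fun N ↦ by simp [Finset.sum_add_distrib, hP, hQ]⟩
  | monomial m c =>
    refine ⟨Polynomial.C c * ∑ i ∈ Finset.range (m + 1),
      Polynomial.C (bernoulli i * ((m + 1).choose i) / (m + 1)) * Polynomial.X ^ (m + 1 - i),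
      fun N ↦ ?_⟩
    simp only [Polynomial.eval_monomial, ← Finset.mul_sum, sum_range_pow, Polynomial.eval_mul,
      Polynomial.eval_C, Polynomial.eval_finsetSum, Polynomial.eval_pow, Polynomial.eval_X]
    congr 1
    refine Finset.sum_congr rfl fun i _ ↦ ?_
    ring

/-- `H` agrees with a polynomial for large arguments. -/
def EventuallyPolynomial (H : ℕ → ℕ) : Prop :=
  ∃ P : Polynomial ℚ, ∀ᶠ k : ℕ in Filter.atTop, (H k : ℚ) = P.eval (k : ℚ)

lemma EventuallyPolynomial.of_shift_add {H H₁ H₂ : ℕ → ℕ} (h₁ : EventuallyPolynomial H₁)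
    (h₂ : EventuallyPolynomial H₂) (h : ∀ k, H₁ (k + 1) + H₂ k = H (k + 1)) :
    EventuallyPolynomial H := by
  obtain ⟨P₁, h₁⟩ := h₁
  obtain ⟨P₂, h₂⟩ := h₂
  obtain ⟨N₁, h₁⟩ := Filter.eventually_atTop.1 h₁
  obtain ⟨N₂, h₂⟩ := Filter.eventually_atTop.1 h₂
  refine ⟨P₁ + P₂.comp (Polynomial.X - 1), Filter.eventually_atTop.2 ⟨N₁ + N₂ + 1, fun k hk ↦ ?_⟩⟩
  obtain ⟨k, rfl⟩ := Nat.exists_eq_add_of_lt (Nat.lt_of_lt_of_le (Nat.succ_pos _) hk)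
  rw [zero_add] at hk ⊢
  rw [← h, Nat.cast_add, h₁ _ (by omega), h₂ _ (by omega)]
  simp

lemma EventuallyPolynomial.of_succ_sub {H H₁ : ℕ → ℕ} (h₁ : EventuallyPolynomial H₁)
    (h : ∀ k, H₁ (k + 1) + H k = H (k + 1)) : EventuallyPolynomial H := by
  obtain ⟨P, hP⟩ := h₁
  obtain ⟨N, hN⟩ := Filter.eventually_atTop.1 hP
  -- The shift by N + 1 makes the j-th summand P(N + j + 1), the increment of H from N + j to N + j
  -- + 1.
  obtain ⟨Q, hQ⟩ := exists_polynomial_eval_eq_sum_range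
    (P.comp (Polynomial.X + Polynomial.C ((N : ℚ) + 1)))
  have key : ∀ j, (H (N + j) : ℚ) = H N + Q.eval (j : ℚ) := by
    intro j
    rw [← hQ]
    induction j with
    | zero => simp
    | succ j ih =>
      rw [Finset.sum_range_succ, ← add_assoc, ← add_assoc, ← ih, ← h, Nat.cast_add,
        hN _ (by omega), add_comm]
      congr 1
      simp only [Polynomial.eval_comp, Polynomial.eval_add, Polynomial.eval_X, Polynomial.eval_C]
      congr 1
      push_cast
      ring
  refine ⟨Polynomial.C (H N : ℚ) + Q.comp (Polynomial.X - Polynomial.C (N : ℚ)),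
    Filter.eventually_atTop.2 ⟨N, fun k hk ↦ ?_⟩⟩
  obtain ⟨j, rfl⟩ := Nat.exists_eq_add_of_le hk
  rw [key]
  simp

/-- Induction on the set T of variables possibly outside I, with Noetherian induction on I inside.
For x new in T, the ideal (I, x) needs fewer variables. If (I : x) = I, its Hilbert function is the
first difference of that of I; otherwise (I : x) is strictly larger and additivity applies. -/
lemma eventuallyPolynomial_hilbertFunction_of_X_mem (T : Finset (Fin n))
    (I : Ideal (MvPolynomial (Fin n) K)) (hI : IsGraded I)
    (hX : ∀ i ∉ T, (X i : MvPolynomial (Fin n) K) ∈ I) :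
    EventuallyPolynomial (hilbertFunction I) := by
  induction T using Finset.induction_on generalizing I with
  | empty =>
    refine ⟨0, Filter.eventually_atTop.2 ⟨1, fun k hk ↦ ?_⟩⟩
    rw [hilbertFunction_eq_zero_iff.2]
    · simp
    · intro p hp
      refine (?_ : idealOfVars (Fin n) K ≤ I) (mem_idealOfVars_of_isHomogeneous hp (by omega))
      rw [Ideal.span_le]
      rintro _ ⟨i, rfl⟩
      exact hX i (Finset.notMem_empty i)
  | insert x T _ ihT =>
    induction I using WellFoundedGT.induction with
    | _ I ih =>
    have hx := isHomogeneous_X K x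
    have h₁ : EventuallyPolynomial (hilbertFunction (I ⊔ Ideal.span {X x})) := by
      refine ihT _ (hI.sup_span hx) fun i hi ↦ ?_
      by_cases hix : i = x
      · subst hix
        exact Ideal.mem_sup_right (Ideal.mem_span_singleton_self _)
      · exact Ideal.mem_sup_left (hX i (by simp [hix, hi]))
    rcases (le_quotBy I (X x)).eq_or_lt with heq | hlt
    · refine h₁.of_succ_sub fun k ↦ ?_
      have := hilbertFunction_add hI hx k
      rwa [← heq] at this
    · exact h₁.of_shift_add (ih _ hlt (hI.quotBy hx) fun i hi ↦ le_quotBy I _ (hX i hi))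
        fun k ↦ hilbertFunction_add hI hx k

/-- The Hilbert polynomial of a graded ideal exists. -/
lemma IsGraded.isHilbertPolynomial {I : Ideal (MvPolynomial (Fin n) K)} (hI : IsGraded I) :
    IsHilbertPolynomial I (hilbertPolynomial I) := by
  have h : ∃ P, IsHilbertPolynomial I P :=
    eventuallyPolynomial_hilbertFunction_of_X_mem Finset.univ I hI (by simp)
  rw [hilbertPolynomial, dif_pos h]
  exact h.choose_spec

/-! ### Multiplicity and its behaviour modulo a regular form -/

lemma IsHilbertPolynomial.unique {I : Ideal (MvPolynomial (Fin n) K)} {P Q : Polynomial ℚ}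
    (hP : IsHilbertPolynomial I P) (hQ : IsHilbertPolynomial I Q) : P = Q := by
  obtain ⟨N, hN⟩ := Filter.eventually_atTop.1 (hP.and hQ)
  refine Polynomial.eq_of_infinite_eval_eq P Q
    (((Set.Ici_infinite N).image (Nat.cast_injective (R := ℚ)).injOn).mono ?_)
  rintro _ ⟨k, hk, rfl⟩
  exact (hN k hk).1.symm.trans (hN k hk).2

/-- Taking components of degree below N has kernel exactly I, since forms of degree at least N
already lie in I. -/
lemma finrank_quotient_eq_sum {I : Ideal (MvPolynomial (Fin n) K)} (hI : IsGraded I) {N : ℕ}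
    (hN : ∀ k, N ≤ k → hilbertFunction I k = 0) :
    Module.finrank K (MvPolynomial (Fin n) K ⧸ I) =
      ∑ k ∈ Finset.range N, hilbertFunction I k := by
  let Φ : MvPolynomial (Fin n) K →ₗ[K] ((k : Fin N) → gradedPart I k) :=
    LinearMap.pi fun k ↦
      ((Ideal.Quotient.mkₐ K I).toLinearMap ∘ₗ homogeneousComponent (k : ℕ)).codRestrict _
        fun p ↦ mem_gradedPart.2 ⟨_, homogeneousComponent_isHomogeneous _ _, rfl⟩
  have hΦ : ∀ p (k : Fin N), ((Φ p k : gradedPart I k) : MvPolynomial (Fin n) K ⧸ I) =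
    Ideal.Quotient.mk I (homogeneousComponent (k : ℕ) p) := fun p k ↦ rfl
  have hsurj : Function.Surjective Φ := by
    intro z
    choose p hp hpz using fun k ↦ mem_gradedPart.1 (z k).2
    refine ⟨∑ k, p k, funext fun k ↦ Subtype.ext ?_⟩
    rw [hΦ, map_sum, Finset.sum_eq_single k, homogeneousComponent_eq_self (hp k), hpz]
    · intro j _ hj
      rw [homogeneousComponent_of_mem (hp j), if_neg]
      exact fun h ↦ hj (Fin.ext h.symm)
    · simp
  have hker : LinearMap.ker Φ = I.restrictScalars K := by
    ext p
    rw [LinearMap.mem_ker, Submodule.restrictScalars_mem]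
    constructor
    · intro h
      rw [← sum_homogeneousComponent p]
      refine Ideal.sum_mem _ fun k _ ↦ ?_
      by_cases hk : k < N
      · rw [← Ideal.Quotient.eq_zero_iff_mem, ← hΦ p ⟨k, hk⟩, h]
        rfl
      · exact hilbertFunction_eq_zero_iff.1 (hN k (by omega)) _
          (homogeneousComponent_isHomogeneous _ _)
    · intro h
      refine funext fun k ↦ Subtype.ext ?_
      rw [hΦ]
      exact Ideal.Quotient.eq_zero_iff_mem.2 (hI.homogeneousComponent_mem h _)
  have e1 := (Φ.quotKerEquivOfSurjective hsurj).finrank_eq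
  rw [hker, (Submodule.Quotient.restrictScalarsEquiv K I).finrank_eq,
    Module.finrank_pi_fintype] at e1
  rw [e1, Finset.sum_range]
  rfl

lemma leadingCoeff_pos_of_eventually_eval_nonneg {P : Polynomial ℚ} (hP : P ≠ 0)
    (h : ∀ᶠ k : ℕ in Filter.atTop, 0 ≤ P.eval (k : ℚ)) : 0 < P.leadingCoeff := by
  by_contra hlc
  have hlc := lt_of_le_of_ne (not_lt.1 hlc) (Polynomial.leadingCoeff_ne_zero.2 hP)
  rcases Nat.eq_zero_or_pos P.natDegree with hd | hd
  · rw [Polynomial.eq_C_of_natDegree_eq_zero hd] at h hlc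
    rw [Polynomial.leadingCoeff_C] at hlc
    obtain ⟨k, hk⟩ := h.exists
    rw [Polynomial.eval_C] at hk
    exact absurd hk (not_le.2 hlc)
  · have ht := (Polynomial.tendsto_atBot_of_leadingCoeff_nonpos P
      (Polynomial.natDegree_pos_iff_degree_pos.1 hd) hlc.le).comp
        (tendsto_natCast_atTop_atTop (R := ℚ))
    obtain ⟨k, hk, hk'⟩ := (h.and (ht.eventually (Filter.eventually_lt_atBot 0))).exists
    exact absurd hk (not_le.2 hk')

lemma eventually_hilbertFunction_eq_zero {I : Ideal (MvPolynomial (Fin n) K)} (hI : IsGraded I)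
    (h0 : hilbertPolynomial I = 0) : ∃ N, ∀ k, N ≤ k → hilbertFunction I k = 0 := by
  obtain ⟨N, hN⟩ := Filter.eventually_atTop.1 hI.isHilbertPolynomial
  refine ⟨N, fun k hk ↦ ?_⟩
  have := hN k hk
  rw [h0, Polynomial.eval_zero] at this
  exact_mod_cast this

lemma multiplicity_pos {I : Ideal (MvPolynomial (Fin n) K)} (hI : IsGraded I) (hne : I ≠ ⊤) :
    0 < multiplicity I := by
  rw [multiplicity]
  split_ifs with h0
  · obtain ⟨N, hN⟩ := eventually_hilbertFunction_eq_zero hI h0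
    rw [finrank_quotient_eq_sum hI (N := N + 1) (fun k hk ↦ hN k (by omega)),
      Finset.sum_range_succ']
    have := Nat.pos_of_ne_zero (hilbertFunction_zero_ne_zero hne)
    exact_mod_cast (by omega)
  · refine mul_pos (by exact_mod_cast Nat.factorial_pos _)
      (leadingCoeff_pos_of_eventually_eval_nonneg h0 ?_)
    filter_upwards [hI.isHilbertPolynomial] with k hk
    rw [← hk]
    positivity

/-- Leading terms cancel. The coefficient of degree D of the translate is the D-th Hasse derivative
at r, a polynomial of degree at most 1. -/
lemma coeff_sub_taylor (P : Polynomial ℚ) (r : ℚ) {D : ℕ} (hD : P.natDegree = D + 1) :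
    (P - Polynomial.taylor r P).natDegree ≤ D ∧
      (P - Polynomial.taylor r P).coeff D = -((D + 1 : ℕ) * r * P.leadingCoeff) := by
  have hc : ∀ k, D + 1 < k → P.coeff k = 0 := fun k hk ↦
    Polynomial.coeff_eq_zero_of_natDegree_lt (by omega)
  constructor
  · rw [Polynomial.natDegree_le_iff_coeff_eq_zero]
    intro k hk
    rw [Polynomial.coeff_sub]
    rcases (Nat.succ_le_of_lt hk).eq_or_lt with rfl | hk
    · have := Polynomial.coeff_taylor_natDegree (r := r) (f := P)
      rw [hD] at this
      rw [Nat.succ_eq_add_one, this, Polynomial.leadingCoeff, hD, sub_self]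
    · rw [hc _ hk, Polynomial.coeff_eq_zero_of_natDegree_lt, sub_self]
      rw [Polynomial.natDegree_taylor, hD]
      exact hk
  · rw [Polynomial.coeff_sub, Polynomial.taylor_coeff, Polynomial.eval_eq_sum_range' (n := 2)]
    · rw [Finset.sum_range_succ, Finset.sum_range_one, Polynomial.hasseDeriv_coeff,
        Polynomial.hasseDeriv_coeff, Polynomial.leadingCoeff, hD, zero_add, add_comm 1 D,
        Nat.choose_self, Nat.choose_succ_self_right]
      push_cast
      ring
    · have := Polynomial.natDegree_hasseDeriv_le P D
      omega

section Regular

variable {I : Ideal (MvPolynomial (Fin n) K)} {f : MvPolynomial (Fin n) K} {a : ℕ}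

lemma hilbertFunction_add_of_regular (hI : IsGraded I) (hf : f.IsHomogeneous a)
    (hreg : ∀ p, f * p ∈ I → p ∈ I) (k : ℕ) :
    hilbertFunction (I ⊔ Ideal.span {f}) (k + a) + hilbertFunction I k =
      hilbertFunction I (k + a) := by
  have hq : quotBy I f = I := le_antisymm hreg (le_quotBy I f)
  have := hilbertFunction_add hI hf k
  rwa [hq] at this

/-- Multiplication by f is injective on S/I, so H_I does not vanish in any degree ja. -/
lemma hilbertPolynomial_ne_zero_of_regular (hI : IsGraded I) (hne : I ≠ ⊤)
    (hf : f.IsHomogeneous a) (ha : a ≠ 0) (hreg : ∀ p, f * p ∈ I → p ∈ I) :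
    hilbertPolynomial I ≠ 0 := by
  intro h0
  obtain ⟨N, hN⟩ := eventually_hilbertFunction_eq_zero hI h0
  have : ∀ j, hilbertFunction I (j * a) ≠ 0 := by
    intro j
    induction j with
    | zero => rw [zero_mul]; exact hilbertFunction_zero_ne_zero hne
    | succ j ih =>
      have := hilbertFunction_add_of_regular hI hf hreg (j * a)
      rw [Nat.succ_mul]
      omega
  exact this N (hN _ (Nat.le_mul_of_pos_right N (Nat.pos_of_ne_zero ha)))

lemma hilbertPolynomial_sup_span (hI : IsGraded I) (hf : f.IsHomogeneous a)
    (hreg : ∀ p, f * p ∈ I → p ∈ I) :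
    hilbertPolynomial (I ⊔ Ideal.span {f}) =
      hilbertPolynomial I - Polynomial.taylor (-(a : ℚ)) (hilbertPolynomial I) := by
  refine (hI.sup_span hf).isHilbertPolynomial.unique ?_
  obtain ⟨N, hN⟩ := Filter.eventually_atTop.1 hI.isHilbertPolynomial
  refine Filter.eventually_atTop.2 ⟨N + a, fun k hk ↦ ?_⟩
  obtain ⟨k, rfl⟩ := Nat.exists_eq_add_of_le' (show a ≤ k by omega)
  have h := congrArg (Nat.cast (R := ℚ)) (hilbertFunction_add_of_regular hI hf hreg k)
  rw [Nat.cast_add, hN k (by omega), hN (k + a) (by omega)] at h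
  rw [Polynomial.eval_sub, Polynomial.taylor_eval, ← h]
  push_cast
  simp

/-- `e(S/(I, f)) = deg f · e(S/I)` for a form `f` regular on `S/I`. -/
lemma multiplicity_sup_span (hI : IsGraded I) (hne : I ≠ ⊤) (hf : f.IsHomogeneous a)
    (ha : a ≠ 0) (hreg : ∀ p, f * p ∈ I → p ∈ I) :
    multiplicity (I ⊔ Ideal.span {f}) = a * multiplicity I := by
  have h0 := hilbertPolynomial_ne_zero_of_regular hI hne hf ha hreg
  have hJ := hilbertPolynomial_sup_span hI hf hreg
  have ha' : (a : ℚ) ≠ 0 := by exact_mod_cast ha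
  rcases hD : (hilbertPolynomial I).natDegree with _ | D
  -- Here S/(I, f) has finite length, so its multiplicity is a dimension. The sum of H_I(k) - H_I(k
  -- - a) telescopes to a values of H_I in the stable range, each equal to c.
  · obtain ⟨c, hc⟩ : ∃ c, hilbertPolynomial I = Polynomial.C c :=
      ⟨_, Polynomial.eq_C_of_natDegree_eq_zero hD⟩
    rw [hc, Polynomial.taylor_C, sub_self] at hJ
    rw [multiplicity, multiplicity, if_pos hJ, if_neg h0, hD, hc, Polynomial.leadingCoeff_C]
    obtain ⟨N₁, hN₁⟩ := eventually_hilbertFunction_eq_zero (hI.sup_span hf) hJ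
    obtain ⟨N₂, hN₂⟩ := Filter.eventually_atTop.1 hI.isHilbertPolynomial
    obtain ⟨N, hN₁', hN₂'⟩ : ∃ N, N₁ ≤ N ∧ N₂ ≤ N := ⟨N₁ + N₂, by omega, by omega⟩
    rw [finrank_quotient_eq_sum (hI.sup_span hf) (N := a + N) (fun k hk ↦ hN₁ k (by omega))]
    have hsum : ∑ k ∈ Finset.range (a + N), hilbertFunction (I ⊔ Ideal.span {f}) k +
        ∑ k ∈ Finset.range N, hilbertFunction I k =
        ∑ k ∈ Finset.range (a + N), hilbertFunction I k := by
      rw [Finset.sum_range_add, Finset.sum_range_add, add_assoc, ← Finset.sum_add_distrib]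
      congr 1
      · exact Finset.sum_congr rfl fun k hk ↦
          hilbertFunction_sup_of_lt hI hf (Finset.mem_range.1 hk)
      · refine Finset.sum_congr rfl fun k _ ↦ ?_
        rw [add_comm a k]
        exact hilbertFunction_add_of_regular hI hf hreg k
    have htail : ∑ k ∈ Finset.range (a + N), hilbertFunction I k =
        ∑ k ∈ Finset.range N, hilbertFunction I k +
          ∑ k ∈ Finset.range a, hilbertFunction I (N + k) := by
      rw [add_comm a N, Finset.sum_range_add]
    have hfin : ∑ k ∈ Finset.range (a + N), hilbertFunction (I ⊔ Ideal.span {f}) k =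
        ∑ k ∈ Finset.range a, hilbertFunction I (N + k) := by omega
    rw [hfin, Nat.cast_sum, Finset.sum_congr rfl (g := fun _ ↦ c)]
    · simp
    · intro k _
      rw [hN₂ _ (by omega), hc, Polynomial.eval_C]
  -- The degree drops to D and the leading coefficient gains the factor (D + 1) a; D! (D + 1) = (D +
  -- 1)! absorbs the rest.
  · obtain ⟨hle, hcoeff⟩ := coeff_sub_taylor (hilbertPolynomial I) (-(a : ℚ)) hD
    rw [← hJ] at hle hcoeff
    have hlc := Polynomial.leadingCoeff_ne_zero.2 h0
    have hcne : (hilbertPolynomial (I ⊔ Ideal.span {f})).coeff D ≠ 0 := by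
      rw [hcoeff]
      have : ((D + 1 : ℕ) : ℚ) ≠ 0 := by exact_mod_cast Nat.succ_ne_zero D
      simp only [ne_eq, neg_eq_zero, mul_eq_zero, not_or]
      exact ⟨⟨this, ha'⟩, hlc⟩
    have hdeg : (hilbertPolynomial (I ⊔ Ideal.span {f})).natDegree = D :=
      le_antisymm hle (Polynomial.le_natDegree_of_ne_zero hcne)
    have hJ0 : hilbertPolynomial (I ⊔ Ideal.span {f}) ≠ 0 := by
      intro h; rw [h] at hcne; simp at hcne
    rw [multiplicity, multiplicity, if_neg hJ0, if_neg h0, hD,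
      ← Polynomial.coeff_natDegree (p := hilbertPolynomial (I ⊔ Ideal.span {f})), hdeg, hcoeff,
      Nat.factorial_succ]
    push_cast
    ring

end Regular

/-! ### The numerical inequalities -/

/-- In the step to s + 1, if m_{s+1} ≤ (s + 1) a, bound the first s + 1 factors by `h₁` and the last
by m_{s+1} + a ≤ (s + 2) a. Otherwise use the induction hypothesis and (s + 1)(m_{s+1} + a) ≤ (s +
2) m_{s+1}. The condition m_0 = 0 serves the base case m'_1 ≤ a. -/
lemma prod_Icc_succ_le {a : ℚ} (ha : 0 ≤ a) {m m' : ℕ → ℚ} (hm : ∀ i, 0 ≤ m i)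
    (hm' : ∀ i, 0 ≤ m' i) (h0 : m 0 = 0) (s : ℕ) (h₁ : ∀ i, 1 ≤ i → i ≤ s → m' i ≤ m i)
    (h₂ : ∀ i ≤ s, m' (i + 1) ≤ m i + a) :
    ∏ i ∈ Finset.Icc 1 (s + 1), m' i ≤ (s + 1) * a * ∏ i ∈ Finset.Icc 1 s, m i := by
  induction s with
  | zero => simpa [h0] using h₂ 0 le_rfl
  | succ s ih =>
    have ih := ih (fun i h h' ↦ h₁ i h (by omega)) (fun i h ↦ h₂ i (by omega))
    have hlast := h₂ (s + 1) le_rfl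
    have hle : ∏ i ∈ Finset.Icc 1 (s + 1), m' i ≤ ∏ i ∈ Finset.Icc 1 (s + 1), m i :=
      Finset.prod_le_prod (fun i _ ↦ hm' i) fun i hi ↦
        h₁ i (Finset.mem_Icc.1 hi).1 (Finset.mem_Icc.1 hi).2
    rw [Finset.prod_Icc_succ_top (by omega) m']
    have hQ : 0 ≤ ∏ i ∈ Finset.Icc 1 s, m i := Finset.prod_nonneg fun i _ ↦ hm i
    rcases le_total (m (s + 1)) ((s + 1) * a) with hcase | hcase
    · refine (mul_le_mul hle (hlast.trans (by linarith : _ ≤ (s + 2) * a)) (hm' _)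
        (Finset.prod_nonneg fun i _ ↦ hm i)).trans_eq ?_
      push_cast
      ring
    · refine (mul_le_mul ih hlast (hm' _) (by positivity)).trans ?_
      rw [Finset.prod_Icc_succ_top (by omega) m]
      have : (s + 1) * (m (s + 1) + a) ≤ (s + 2) * m (s + 1) := by linarith
      have h3 := mul_le_mul_of_nonneg_left this (mul_nonneg ha hQ)
      push_cast
      linarith

/-- The same dichotomy with all inequalities reversed; now m_0 ≥ 0 is enough for the base case. -/
lemma le_prod_Icc_succ {a : ℚ} (ha : 0 ≤ a) {m m' : ℕ → ℚ} (hm : ∀ i, 0 ≤ m i)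
    (hm' : ∀ i, 0 ≤ m' i) (s : ℕ) (h₁ : ∀ i, 1 ≤ i → i ≤ s → m i ≤ m' i)
    (h₂ : ∀ i ≤ s, m i + a ≤ m' (i + 1)) :
    (s + 1) * a * ∏ i ∈ Finset.Icc 1 s, m i ≤ ∏ i ∈ Finset.Icc 1 (s + 1), m' i := by
  induction s with
  | zero => simpa using (le_add_of_nonneg_left (hm 0)).trans (h₂ 0 le_rfl)
  | succ s ih =>
    have ih := ih (fun i h h' ↦ h₁ i h (by omega)) (fun i h ↦ h₂ i (by omega))
    have hlast := h₂ (s + 1) le_rfl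
    have hle : ∏ i ∈ Finset.Icc 1 (s + 1), m i ≤ ∏ i ∈ Finset.Icc 1 (s + 1), m' i :=
      Finset.prod_le_prod (fun i _ ↦ hm i) fun i hi ↦
        h₁ i (Finset.mem_Icc.1 hi).1 (Finset.mem_Icc.1 hi).2
    have hP' : 0 ≤ ∏ i ∈ Finset.Icc 1 (s + 1), m' i := Finset.prod_nonneg fun i _ ↦ hm' i
    rw [Finset.prod_Icc_succ_top (by omega) m']
    have hQ : 0 ≤ ∏ i ∈ Finset.Icc 1 s, m i := Finset.prod_nonneg fun i _ ↦ hm i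
    rcases le_total ((s + 1) * a) (m (s + 1)) with hcase | hcase
    · refine le_trans (le_of_eq ?_) (mul_le_mul hle
        ((by linarith : (s + 2) * a ≤ _).trans hlast) (by positivity) hP')
      push_cast
      ring
    · refine le_trans ?_ (mul_le_mul ih hlast (add_nonneg (hm _) ha) hP')
      rw [Finset.prod_Icc_succ_top (by omega) m]
      have : (s + 2) * m (s + 1) ≤ (s + 1) * (m (s + 1) + a) := by linarith
      have h3 := mul_le_mul_of_nonneg_left this (mul_nonneg ha hQ)
      push_cast
      linarith

/-! ### Adding one form, and induction along the sequence -/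

/-- The bounds on the multiplicity of `S/I` in terms of the first `s` shifts. -/
def HasMultiplicityBounds (I : Ideal (MvPolynomial (Fin n) K)) (s : ℕ) : Prop :=
  (∏ i ∈ Finset.Icc 1 s, (minShift I i : ℚ)) / (s.factorial : ℚ) ≤ multiplicity I ∧
    multiplicity I ≤ (∏ i ∈ Finset.Icc 1 s, (maxShift I i : ℚ)) / (s.factorial : ℚ)

section Step

variable {I : Ideal (MvPolynomial (Fin n) K)} {f : MvPolynomial (Fin n) K} {a s : ℕ}

/-- An empty set of shifts has `sSup` equal to 0, and the upper bound would contradict e(S/I) > 0.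
-/
lemma HasMultiplicityBounds.shifts_nonempty (hb : HasMultiplicityBounds I s) (hI : IsGraded I)
    (hne : I ≠ ⊤) {i : ℕ} (hi : 1 ≤ i) (his : i ≤ s) : (shifts I i).Nonempty := by
  by_contra hempty
  rw [Set.not_nonempty_iff_eq_empty] at hempty
  have hM : (maxShift I i : ℚ) = 0 := by simp [maxShift, hempty]
  have h := hb.2
  rw [Finset.prod_eq_zero (Finset.mem_Icc.2 ⟨hi, his⟩) hM, zero_div] at h
  exact absurd (multiplicity_pos hI hne) (not_lt.2 h)

/-- The multiplicity grows by a and the factorial by s + 1, matching the factor (s + 1) a in the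
product inequalities. -/
lemma HasMultiplicityBounds.sup_span (hb : HasMultiplicityBounds I s) (hI : IsGraded I)
    (hne : I ≠ ⊤) (hF : Nonempty (MinimalResolution I)) (hf : f.IsHomogeneous a) (ha : a ≠ 0)
    (hreg : ∀ p, f * p ∈ I → p ∈ I) : HasMultiplicityBounds (I ⊔ Ideal.span {f}) (s + 1) := by
  have hz : 0 ∈ shifts I 0 := by
    obtain ⟨F⟩ := hF
    rw [F.shifts_eq_range hI]
    exact F.zero_mem_range_shift_zero hI hne
  have hnonempty : ∀ i ≤ s, (shifts I i).Nonempty := by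
    intro i hi
    rcases Nat.eq_zero_or_pos i with rfl | hpos
    · exact ⟨0, hz⟩
    · exact hb.shifts_nonempty hI hne hpos hi
  have hbdd : ∀ i, BddAbove (shifts (I ⊔ Ideal.span {f}) i) :=
    bddAbove_shifts (hI.sup_span hf) ⟨hF.some.cone hf ha hreg⟩
  have hmin : ∀ i ≤ s, minShift I i ∈ shifts I i := fun i hi ↦ Nat.sInf_mem (hnonempty i hi)
  have hmax : ∀ i ≤ s, maxShift I i ∈ shifts I i := fun i hi ↦
    Nat.sSup_mem (hnonempty i hi) (bddAbove_shifts hI hF i)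
  have hm0 : minShift I 0 = 0 := Nat.le_zero.1 (Nat.sInf_le hz)
  have hs : (0 : ℚ) < s.factorial := by exact_mod_cast Nat.factorial_pos s
  have hs1 : (0 : ℚ) < s + 1 := by positivity
  have ha0 : (0 : ℚ) ≤ a := Nat.cast_nonneg a
  rw [HasMultiplicityBounds, multiplicity_sup_span hI hne hf ha hreg, Nat.factorial_succ]
  push_cast
  constructor
  · rw [div_le_iff₀ (mul_pos hs1 hs)]
    refine (prod_Icc_succ_le ha0 (m := fun i ↦ (minShift I i : ℚ))
      (fun i ↦ Nat.cast_nonneg _) (fun i ↦ Nat.cast_nonneg _) (by simp [hm0]) s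
      (fun i _ hi ↦ ?_) (fun i hi ↦ ?_)).trans ?_
    · exact_mod_cast Nat.sInf_le (mem_shifts_sup_span hf ha hreg (hmin i hi))
    · exact_mod_cast Nat.sInf_le (add_mem_shifts_sup_span hf ha hreg (hmin i hi))
    · have h := (div_le_iff₀ hs).1 hb.1
      have := mul_le_mul_of_nonneg_left h (mul_nonneg hs1.le ha0)
      linarith
  · rw [le_div_iff₀ (mul_pos hs1 hs)]
    refine le_trans ?_ (le_prod_Icc_succ ha0 (m := fun i ↦ (maxShift I i : ℚ))
      (fun i ↦ Nat.cast_nonneg _) (fun i ↦ Nat.cast_nonneg _) s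
      (fun i _ hi ↦ ?_) (fun i hi ↦ ?_))
    · have h := (le_div_iff₀ hs).1 hb.2
      have := mul_le_mul_of_nonneg_left h (mul_nonneg hs1.le ha0)
      linarith
    · exact_mod_cast le_csSup (hbdd _) (mem_shifts_sup_span hf ha hreg (hmax i hi))
    · exact_mod_cast le_csSup (hbdd _) (add_mem_shifts_sup_span hf ha hreg (hmax i hi))

/-- Translates regularity on the module S/I into membership in ideals of S. -/
lemma mk_mem_smul_top_iff (A : Ideal (MvPolynomial (Fin n) K)) (p : MvPolynomial (Fin n) K) :
    (Ideal.Quotient.mk I p) ∈ (A • ⊤ : Submodule (MvPolynomial (Fin n) K)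
      (MvPolynomial (Fin n) K ⧸ I)) ↔ p ∈ I ⊔ A := by
  have h : (A • ⊤ : Submodule (MvPolynomial (Fin n) K) (MvPolynomial (Fin n) K ⧸ I)) =
      Submodule.map (Submodule.mkQ I) A := by
    rw [← Submodule.range_mkQ I, ← Submodule.map_top, ← Submodule.map_smul'', Ideal.smul_eq_mul,
      Ideal.mul_top]
  rw [h, ← Submodule.comap_map_mkQ, Submodule.mem_comap]
  rfl

/-- A constant f is either 0, and then regularity forces I = S, or a unit. Positive degree is what
makes the cone minimal. -/
lemma degree_ne_zero_of_regular (hne : I ⊔ Ideal.span {f} ≠ ⊤)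
    (hf : f.IsHomogeneous a) (hreg : ∀ p, f * p ∈ I → p ∈ I) : a ≠ 0 := by
  rintro rfl
  have hC : f = C (coeff 0 f) := by
    rw [← homogeneousComponent_zero, homogeneousComponent_eq_self hf]
  by_cases hc : coeff 0 f = 0
  · rw [hc, C_0] at hC
    have h1 : (1 : MvPolynomial (Fin n) K) ∈ I := hreg 1 (by rw [hC, zero_mul]; exact I.zero_mem)
    exact hne (Ideal.eq_top_of_unit_mem _ 1 1 (Ideal.mem_sup_left h1) (one_mul 1))
  · refine hne (Ideal.eq_top_of_isUnit_mem _
      (Ideal.mem_sup_right (Ideal.mem_span_singleton_self f)) ?_)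
    rw [hC]
    exact (isUnit_iff_ne_zero.2 hc).map C

lemma HasMultiplicityBounds.sup_ofList (hb : HasMultiplicityBounds I s) (hI : IsGraded I)
    (hF : Nonempty (MinimalResolution I)) (rs : List (MvPolynomial (Fin n) K))
    (hrs : ∀ g ∈ rs, ∃ d : ℕ, g.IsHomogeneous d)
    (hreg : RingTheory.Sequence.IsRegular (MvPolynomial (Fin n) K ⧸ I) rs) (k : ℕ)
    (hk : k ≤ rs.length) :
    IsGraded (I ⊔ Ideal.ofList (rs.take k)) ∧
      Nonempty (MinimalResolution (I ⊔ Ideal.ofList (rs.take k))) ∧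
      HasMultiplicityBounds (I ⊔ Ideal.ofList (rs.take k)) (s + k) := by
  have htop : I ⊔ Ideal.ofList rs ≠ ⊤ := by
    intro h
    refine hreg.top_ne_smul (eq_top_iff.2 fun z _ ↦ ?_).symm
    obtain ⟨p, rfl⟩ := Ideal.Quotient.mk_surjective z
    rw [mk_mem_smul_top_iff, h]
    trivial
  have hproper : ∀ k, I ⊔ Ideal.ofList (rs.take k) ≠ ⊤ := by
    intro k h
    refine htop (top_le_iff.1 (h ▸ sup_le_sup_left (Ideal.span_mono ?_) I))
    exact fun x hx ↦ List.mem_of_mem_take hx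
  induction k with
  | zero => simpa using ⟨hI, hF, hb⟩
  | succ k ih =>
    obtain ⟨hJ, hJF, hJb⟩ := ih (by omega)
    have hklt : k < rs.length := by omega
    have hsucc : I ⊔ Ideal.ofList (rs.take (k + 1)) =
        (I ⊔ Ideal.ofList (rs.take k)) ⊔ Ideal.span {rs[k]} := by
      rw [List.take_succ_eq_append_getElem hklt, Ideal.ofList_append, Ideal.ofList_singleton,
        sup_assoc]
    obtain ⟨d, hd⟩ := hrs rs[k] (List.getElem_mem hklt)
    have hregk : ∀ p, rs[k] * p ∈ I ⊔ Ideal.ofList (rs.take k) →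
        p ∈ I ⊔ Ideal.ofList (rs.take k) := by
      intro p hp
      rw [← mk_mem_smul_top_iff] at hp ⊢
      rw [← Submodule.Quotient.mk_eq_zero] at hp ⊢
      refine hreg.regular_mod_prev k hklt ?_
      dsimp only
      rw [smul_zero, ← hp]
      rfl
    have hd0 : d ≠ 0 := degree_ne_zero_of_regular (hsucc ▸ hproper (k + 1)) hd hregk
    rw [hsucc]
    exact ⟨hJ.sup_span hd, ⟨hJF.some.cone hd hd0 hregk⟩,
      hJb.sup_span hJ (hproper k) hJF hd hd0 hregk⟩

end Step

end GradedIdeal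

end

theorem theorem1p1 {K : Type*} [Field K] {n : ℕ}
    (I : Ideal (MvPolynomial (Fin n) K))
    (hI : GradedIdeal.IsGraded I)
    (s : ℕ) (hs : I.height = s)
    (hlower : (∏ i ∈ Finset.Icc 1 s, (GradedIdeal.minShift I i : ℚ)) / (s.factorial : ℚ)
      ≤ GradedIdeal.multiplicity I)
    (hupper : GradedIdeal.multiplicity I
      ≤ (∏ i ∈ Finset.Icc 1 s, (GradedIdeal.maxShift I i : ℚ)) / (s.factorial : ℚ))
    (m : ℕ) (f : Fin m → MvPolynomial (Fin n) K)
    (hf : ∀ j, ∃ d : ℕ, (f j).IsHomogeneous d)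
    (hreg : RingTheory.Sequence.IsRegular (MvPolynomial (Fin n) K ⧸ I) (List.ofFn f)) :
    (∏ i ∈ Finset.Icc 1 (s + m),
        (GradedIdeal.minShift (I ⊔ Ideal.span (Set.range f)) i : ℚ)) / ((s + m).factorial : ℚ)
      ≤ GradedIdeal.multiplicity (I ⊔ Ideal.span (Set.range f)) ∧
    GradedIdeal.multiplicity (I ⊔ Ideal.span (Set.range f))
      ≤ (∏ i ∈ Finset.Icc 1 (s + m),
        (GradedIdeal.maxShift (I ⊔ Ideal.span (Set.range f)) i : ℚ)) / ((s + m).factorial : ℚ) := by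
  have hb : GradedIdeal.HasMultiplicityBounds I s := ⟨hlower, hupper⟩
  have hne : I ≠ ⊤ := Ideal.Quotient.nontrivial_iff.1 hreg.nontrivial
  -- For s > 0 the bounds force a shift in degree 1, and a shift comes with a resolution; for s = 0
  -- the ideal is zero because S is a domain.
  have hF : Nonempty (GradedIdeal.MinimalResolution I) := by
    rcases Nat.eq_zero_or_pos s with rfl | hpos
    · have hbot : I = ⊥ := Ideal.height_eq_zero_iff_eq_bot.1 (by simpa using hs)
      subst hbot
      exact ⟨GradedIdeal.MinimalResolution.bot⟩
    · obtain ⟨_, F, _⟩ := hb.shifts_nonempty hI hne le_rfl hpos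
      exact ⟨F⟩
  have hspan : Ideal.ofList ((List.ofFn f).take m) = Ideal.span (Set.range f) := by
    rw [List.take_of_length_le (by simp), Ideal.ofList]
    congr 1
    ext x
    simp [List.mem_ofFn]
  have h := (hb.sup_ofList hI hF (List.ofFn f) (by simpa [List.mem_ofFn] using hf) hreg m
    (by simp)).2.2
  rwa [hspan] at h
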